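/- Let $K=(\mathbb R\times\mathbb Q_2)/\mathbb Z[1/2]$ be the $2$-adic solenoid, where $\mathbb Z[1/2]$ is embedded diagonally, let $m_K$ be its Haar probability measure and let $T$ be the automorphism $T[x,y]=[2x,2y]$. For $y\in\mathbb Q_2$ let $\{y\}_2\in\mathbb Z[1/2]\cap[0,1)$ be such that $y-\{y\}_2\in\mathbb Z_2$, and let $\pi:K\to\mathbb R/\mathbb Z$ be the projection $\pi[x,y]=x-\{y\}_2+\mathbb Z$. For $q\in(1/2,3/4]$ put $B^{(q)}=\pi^{-1}\big(([0,1/2]\cup(q,1))+\mathbb Z\big)$. The suspension process with parameters $(Z,\theta,T,B)$, where $T$ is an invertible ergodic measure-preserving transformation of a standard probability space $(Z,\theta)$ and $B\subset Z$ is a Borel set with $\bigcup_{n\in\mathbb Z}T^{-n}B=Z$, is defined as follows. Let $\Omega=(\mathbb R\times Z)/\mathbb Z$ be the quotient by the action $(t,z).n=(t-n,T^nz)$, let $\mathbb P$ be the image in $\Omega$ of $\mathrm{Vol}_1|_{[0,1)}\otimes\theta$, and let $\mathbb R$ act on $\Omega$ by $x.[t,z]=[x+t,z]$. The process is $p_{[t,z]}=\delta_{\Lambda_z-t}=\sum_{x\in\Lambda_z-t}\delta_x$,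 where $\Lambda_z=\{n\in\mathbb Z: T^nz\in B\}$. A set $D\subset\mathbb R$ is a Meyer set if $D+C=\mathbb R$ for some compact $C$ and $D-D$ is uniformly discrete. A Meyerian point process in $\mathbb R$ is a locally square-integrable invariant simple point process over an ergodic probability-measure-preserving action of $\mathbb R$ which is almost surely the Dirac comb of a Meyer set. A set $A\subset\mathbb Z$ is $2$-syndetic if two of its translates cover $\mathbb Z$. A point process $p$ is $2$-syndetic in a random translate of $\mathbb Z$ if there is a real-valued random variable $\tau$ such that for every $\omega$ we have $p_\omega=\delta_{A+\tau(\omega)}$ for some $2$-syndetic set $A\subset\mathbb Z$. The asymptotic number variance of $p$ is $\mathrm{ANV}(p)=\lim_{R\to\infty}\mathrm{Var}(p_\omega((-R,R)))/(2R)$. \textbf{Theorem.} There is a dense subset $S$ of $(1/2,3/4]$ such that for every $q\in S$ the quadruple $(K,m_K,T,B^{(q)})$ satisfies the above conditions on the parameters of a suspension process, and, with $B=B^{(q)}$, (i) $\sum_{n=1}^\infty n\,\big|m_K(B\cap T^{-n}B)-m_K(B)^2\big|<\infty$; (ii) the function $f=\chi_B-m_K(B)$ is not an $L^2$-coboundary,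 i.e. there is no $F\in L^2(K,m_K)$ with $f=F-F\circ T$ almost everywhere; (iii) the suspension process $p^{(q)}$ with parameters $(K,m_K,T,B^{(q)})$ is a Meyerian point process in $\mathbb R$ which is $2$-syndetic in a random translate of $\mathbb Z$; (iv) the limit $\mathrm{ANV}(p^{(q)})$ exists and is strictly positive. -/

import Mathlib

open MeasureTheory ProbabilityTheory Filter Topology
open scoped Pointwise ENNReal

/-! ### Point sets in the real line and in the integers -/

/-- `D` is uniformly discrete: distinct points of `D` are at distance at least some `r > 0`. -/
def IsUniformlyDiscrete (D : Set ℝ) : Prop :=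
  ∃ r : ℝ, 0 < r ∧ ∀ x ∈ D, ∀ y ∈ D, x ≠ y → r ≤ dist x y

/-- `D` is relatively dense: `D + C = ℝ` for some compact set `C`. -/
def IsRelativelyDense (D : Set ℝ) : Prop :=
  ∃ C : Set ℝ, IsCompact C ∧ D + C = Set.univ

/-- Meyer sets: relatively dense sets whose difference set is uniformly discrete. -/
structure IsMeyerSet (D : Set ℝ) : Prop where
  relativelyDense : IsRelativelyDense D
  uniformlyDiscrete_sub : IsUniformlyDiscrete (D - D)

/-- `D` is locally finite: it meets every compact set in a finite set. -/
def IsLocallyFiniteSet (D : Set ℝ) : Prop :=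
  ∀ C : Set ℝ, IsCompact C → (D ∩ C).Finite

/-- A set of integers is `2`-syndetic if two of its translates cover the integers. -/
def IsTwoSyndetic (A : Set ℤ) : Prop :=
  ∃ a b : ℤ, (a +ᵥ A) ∪ (b +ᵥ A) = Set.univ

/-- The Dirac comb `δ_D = ∑_{x ∈ D} δ_x`. -/
noncomputable def diracComb (D : Set ℝ) : Measure ℝ :=
  Measure.sum fun x : D => Measure.dirac (x : ℝ)

/-! ### Invariant random measures and point processes in the real line -/

section PointProcess

variable {Ω : Type*} [MeasurableSpace Ω]

/-- `p` is a locally square-integrable invariant random measure in `ℝ`, defined on the standard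
probability space `(Ω, P)`, on which `ℝ` acts measurably and measure-preservingly.  The space of
measures carries the `σ`-algebra generated by the evaluations at Borel sets. -/
structure IsInvariantRandomMeasure [AddAction ℝ Ω] (P : Measure Ω) (p : Ω → Measure ℝ) :
    Prop where
  standardBorel : StandardBorelSpace Ω
  isProbabilityMeasure : IsProbabilityMeasure P
  measurable_action : MeasurableVAdd₂ ℝ Ω
  invariant : VAddInvariantMeasure ℝ Ω P
  measurable : Measurable p
  isLocallyFinite : ∀ ω, IsLocallyFiniteMeasure (p ω)
  equivariant : ∀ (x : ℝ) (ω : Ω), p (x +ᵥ ω) = (p ω).map (fun y => y - x)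
  locallySquareIntegrable : ∀ A : Set ℝ, MeasurableSet A → Bornology.IsBounded A →
    ∫⁻ ω, (p ω A) ^ 2 ∂P < ∞

/-- Invariant simple point processes: almost surely `p ω` is the Dirac comb of a locally finite
set. -/
structure IsSimplePointProcess [AddAction ℝ Ω] (P : Measure Ω) (p : Ω → Measure ℝ) : Prop
    extends IsInvariantRandomMeasure P p where
  simple : ∀ᵐ ω ∂P, ∃ D : Set ℝ, IsLocallyFiniteSet D ∧ p ω = diracComb D

/-- Meyerian point processes: ergodic simple point processes whose realizations are almost surely
Meyer sets. -/
structure IsMeyerianPointProcess [AddAction ℝ Ω] (P : Measure Ω) (p : Ω → Measure ℝ) : Prop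
    extends IsSimplePointProcess P p where
  ergodic : ErgodicVAdd ℝ Ω P
  meyer : ∀ᵐ ω ∂P, ∃ D : Set ℝ, IsMeyerSet D ∧ p ω = diracComb D

/-- `p` is `2`-syndetic in a random translate of `ℤ`: for a random variable `τ` and every `ω`,
the measure `p ω` is the Dirac comb of `A + τ ω` for a `2`-syndetic set `A ⊆ ℤ`. -/
def IsTwoSyndeticInRandomTranslate (p : Ω → Measure ℝ) : Prop :=
  ∃ τ : Ω → ℝ, Measurable τ ∧ ∀ ω, ∃ A : Set ℤ, IsTwoSyndetic A ∧
    p ω = diracComb ((fun n : ℤ => (n : ℝ) + τ ω) '' A)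

/-- The variance of the number of points in the interval `B_R = (-R, R)`. -/
noncomputable def numberVariance (P : Measure Ω) (p : Ω → Measure ℝ) (R : ℝ) : ℝ :=
  variance (fun ω => (p ω).real (Metric.ball 0 R)) P

/-- The asymptotic number variance of `p` exists and equals `v`. -/
def HasAsymptoticNumberVariance (P : Measure Ω) (p : Ω → Measure ℝ) (v : ℝ) : Prop :=
  Tendsto (fun R : ℝ => numberVariance P p R / volume.real (Metric.ball (0 : ℝ) R)) atTop (𝓝 v)

end PointProcess

/-! ### Suspension processes -/

section Suspension

variable {Z : Type*}

/-- The orbit relation of the right action `(t, z).n = (t - n, T ^ n z)` of `ℤ` on `ℝ × Z`. -/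
def suspensionSetoid (T : Equiv.Perm Z) : Setoid (ℝ × Z) where
  r a b := ∃ n : ℤ, b = (a.1 - n, (T ^ n) a.2)
  iseqv :=
    { refl := fun a => ⟨0, by simp⟩
      symm := by
        rintro a b ⟨n, rfl⟩
        exact ⟨-n, by simp⟩
      trans := by
        rintro a b c ⟨n, rfl⟩ ⟨m, rfl⟩
        exact ⟨m + n, by rw [zpow_add]; simp [sub_sub, add_comm]⟩ }

/-- The suspension space `Ω = (ℝ × Z) / ℤ`. -/
def Suspension (T : Equiv.Perm Z) : Type _ := Quotient (suspensionSetoid T)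

namespace Suspension

variable (T : Equiv.Perm Z)

/-- The class `[t, z]`. -/
def mk (a : ℝ × Z) : Suspension T := Quotient.mk (suspensionSetoid T) a

/-- The quotient `σ`-algebra. -/
instance [MeasurableSpace Z] : MeasurableSpace (Suspension T) :=
  MeasurableSpace.map (mk T) inferInstance

/-- The action `x.[t, z] = [x + t, z]` of `ℝ`. -/
instance : AddAction ℝ (Suspension T) where
  vadd x := Quotient.map (fun a : ℝ × Z => (x + a.1, a.2)) (by
    rintro a b ⟨n, rfl⟩
    exact ⟨n, by simp [add_sub_assoc]⟩)
  zero_vadd := by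
    rintro ⟨a⟩
    exact congrArg (mk T) (by simp)
  add_vadd := by
    rintro x y ⟨a⟩
    exact congrArg (mk T) (by simp [add_assoc])

/-- The probability measure induced by `Vol|_{[0,1)} ⊗ θ`. -/
noncomputable def measure [MeasurableSpace Z] (θ : Measure Z) : Measure (Suspension T) :=
  ((volume.restrict (Set.Ico (0 : ℝ) 1)).prod θ).map (mk T)

/-- The set `Λ_z - t`, where `Λ_z = {n ∈ ℤ | T ^ n z ∈ B}`, attached to `[t, z]`. -/
def points (B : Set Z) : Suspension T → Set ℝ :=
  Quotient.lift (fun a : ℝ × Z => {x : ℝ | ∃ n : ℤ, (T ^ n) a.2 ∈ B ∧ x = n - a.1}) (by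
    rintro a b ⟨m, rfl⟩
    ext x
    constructor
    · rintro ⟨n, hn, rfl⟩
      refine ⟨n - m, ?_, by push_cast; ring⟩
      rw [← Equiv.Perm.mul_apply, ← zpow_add, sub_add_cancel]
      exact hn
    · rintro ⟨n, hn, rfl⟩
      refine ⟨n + m, ?_, by push_cast; ring⟩
      rw [zpow_add, Equiv.Perm.mul_apply]
      exact hn)

/-- The suspension process with parameters `(Z, θ, T, B)`, on the probability space
`(Suspension T, Suspension.measure T θ)`. -/
noncomputable def process (B : Set Z) (ω : Suspension T) : Measure ℝ :=
  diracComb (points T B ω)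

end Suspension

variable [MeasurableSpace Z]

/-- The standing assumptions on the parameters `(Z, θ, T, B)` of a suspension process. -/
structure IsSuspensionParameter (θ : Measure Z) (T : Equiv.Perm Z) (B : Set Z) : Prop where
  standardBorel : StandardBorelSpace Z
  isProbabilityMeasure : IsProbabilityMeasure θ
  ergodic : Ergodic T θ
  measurable_symm : Measurable T.symm
  measurableSet : MeasurableSet B
  iUnion_eq : ⋃ n : ℤ, (T ^ n) ⁻¹' B = Set.univ

/-- The condition `∑_{n ≥ 1} n |θ(B ∩ T⁻ⁿB) - θ(B)²| < ∞`. -/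
def HasSummableCorrelations (θ : Measure Z) (T : Equiv.Perm Z) (B : Set Z) : Prop :=
  Summable fun n : ℕ => (n : ℝ) * |θ.real (B ∩ (T ^ n) ⁻¹' B) - θ.real B ^ 2|

/-- `f` is an `L²`-coboundary: `f = F - F ∘ T` almost everywhere for some `F ∈ L²(θ)`. -/
def IsL2Coboundary (θ : Measure Z) (T : Equiv.Perm Z) (f : Z → ℂ) : Prop :=
  ∃ F : Z → ℂ, MemLp F 2 θ ∧ f =ᵐ[θ] fun z => F z - F (T z)

/-- The function `χ_B - θ(B)`. -/
noncomputable def centeredIndicator (θ : Measure Z) (B : Set Z) (z : Z) : ℂ :=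
  B.indicator (fun _ => (1 : ℂ)) z - (θ.real B : ℂ)

end Suspension

/-! ### The `2`-adic solenoid -/

/-- `ℤ[1/2]`, diagonally embedded into `ℝ × ℚ₂`. -/
noncomputable def diagonalDyadic : AddSubgroup (ℝ × ℚ_[2]) where
  carrier := {v | ∃ (k : ℤ) (N : ℕ), v = ((k : ℝ) / 2 ^ N, (k : ℚ_[2]) / 2 ^ N)}
  zero_mem' := ⟨0, 0, by simp; rfl⟩
  neg_mem' := by
    rintro _ ⟨k, N, rfl⟩
    exact ⟨-k, N, by simp [neg_div]⟩
  add_mem' := by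
    rintro _ _ ⟨k, N, rfl⟩ ⟨l, M, rfl⟩
    refine ⟨k * 2 ^ M + l * 2 ^ N, N + M, ?_⟩
    rw [Prod.mk_add_mk]
    ext
    · push_cast
      simp only [pow_add]
      field_simp
    · push_cast
      simp only [pow_add]
      field_simp

/-- The solenoid `K = (ℝ × ℚ₂) / ℤ[1/2]`. -/
def Solenoid : Type := (ℝ × ℚ_[2]) ⧸ diagonalDyadic

/-- A dyadic rational which is a `2`-adic integer is an integer. -/
theorem exists_int_of_dyadic_norm_le_one (k : ℤ) (N : ℕ)
    (h : ‖(k : ℚ_[2]) / 2 ^ N‖ ≤ 1) : ∃ m : ℤ, (k : ℝ) / 2 ^ N = m := by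
  have h2 : ‖(2 : ℚ_[2])‖ = 2⁻¹ := by simpa using Padic.norm_p (p := 2)
  have hk : ‖(k : ℚ_[2])‖ ≤ ((2 : ℕ) : ℝ) ^ (-N : ℤ) := by
    rw [norm_div, norm_pow, h2, div_le_one (by positivity)] at h
    simpa using h
  obtain ⟨m, hm⟩ := (Padic.norm_int_le_pow_iff_dvd k N).1 hk
  refine ⟨m, ?_⟩
  rw [hm]
  push_cast
  field_simp

/-- Every `2`-adic number differs from a dyadic rational in `[0, 1)` by a `2`-adic integer. -/
theorem exists_dyadic_fract (y : ℚ_[2]) : ∃ r : ℚ, (0 ≤ r ∧ r < 1) ∧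
    (∃ (k : ℤ) (N : ℕ), r = k / 2 ^ N) ∧ ‖y - (r : ℚ_[2])‖ ≤ 1 := by
  have h2 : ‖(2 : ℚ_[2])‖ = 2⁻¹ := by simpa using Padic.norm_p (p := 2)
  obtain ⟨N, hN⟩ := pow_unbounded_of_one_lt ‖y‖ (one_lt_two : (1 : ℝ) < 2)
  have hz : ‖y * 2 ^ N‖ ≤ 1 := by
    rw [norm_mul, norm_pow, h2, inv_pow, ← div_eq_mul_inv, div_le_one (by positivity)]
    exact hN.le
  let z : ℤ_[2] := ⟨y * 2 ^ N, hz⟩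
  have hlt : z.appr N < 2 ^ N := PadicInt.appr_lt z N
  have hs := (PadicInt.norm_le_pow_iff_mem_span_pow (z - (z.appr N : ℤ_[2])) N).2 (PadicInt.appr_spec N z)
  rw [PadicInt.norm_def, PadicInt.coe_sub, PadicInt.coe_natCast] at hs
  have hs' : ‖y * 2 ^ N - (z.appr N : ℚ_[2])‖ ≤ (2 ^ N)⁻¹ := by simpa [z] using hs
  refine ⟨(z.appr N : ℚ) / 2 ^ N, ⟨by positivity, ?_⟩, ⟨z.appr N, N, by simp⟩, ?_⟩
  · rw [div_lt_one (by positivity)]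
    exact_mod_cast hlt
  · have e : y - (((z.appr N : ℚ) / 2 ^ N : ℚ) : ℚ_[2])
        = (y * 2 ^ N - (z.appr N : ℚ_[2])) / 2 ^ N := by
      push_cast
      field_simp
    rw [e, norm_div, norm_pow, h2, inv_pow, div_le_one (by positivity)]
    exact hs'

/-- The `2`-adic fractional part `{y}₂`: the dyadic rational in `[0, 1)` with
`y - {y}₂ ∈ ℤ₂`. -/
noncomputable def twoAdicFract (y : ℚ_[2]) : ℚ := (exists_dyadic_fract y).choose

/-- Two dyadic rationals which agree up to a `2`-adic integer agree modulo `1`. -/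
theorem coe_eq_of_norm_sub_le_one {r s : ℚ} (hr : ∃ (k : ℤ) (N : ℕ), r = k / 2 ^ N)
    (hs : ∃ (k : ℤ) (N : ℕ), s = k / 2 ^ N) (h : ‖(r : ℚ_[2]) - (s : ℚ_[2])‖ ≤ 1) :
    (((r : ℚ) : ℝ) : UnitAddCircle) = ((s : ℚ) : ℝ) := by
  obtain ⟨k, N, rfl⟩ := hr
  obtain ⟨l, M, rfl⟩ := hs
  have e : ((k / 2 ^ N : ℚ) : ℚ_[2]) - ((l / 2 ^ M : ℚ) : ℚ_[2])
      = ((k * 2 ^ M - l * 2 ^ N : ℤ) : ℚ_[2]) / 2 ^ (N + M) := by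
    push_cast
    simp only [pow_add]
    field_simp
  rw [e] at h
  obtain ⟨m, hm⟩ := exists_int_of_dyadic_norm_le_one _ _ h
  rw [← sub_eq_zero, ← AddCircle.coe_sub, AddCircle.coe_eq_zero_iff]
  refine ⟨m, ?_⟩
  rw [zsmul_one, ← hm]
  push_cast
  simp only [pow_add]
  field_simp

theorem dyadic_add {r s : ℚ} (hr : ∃ (k : ℤ) (N : ℕ), r = k / 2 ^ N)
    (hs : ∃ (k : ℤ) (N : ℕ), s = k / 2 ^ N) : ∃ (k : ℤ) (N : ℕ), r + s = k / 2 ^ N := by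
  obtain ⟨k, N, rfl⟩ := hr
  obtain ⟨l, M, rfl⟩ := hs
  refine ⟨k * 2 ^ M + l * 2 ^ N, N + M, ?_⟩
  push_cast
  simp only [pow_add]
  field_simp

namespace Solenoid

noncomputable instance : AddCommGroup Solenoid :=
  inferInstanceAs (AddCommGroup ((ℝ × ℚ_[2]) ⧸ diagonalDyadic))

instance : TopologicalSpace Solenoid :=
  inferInstanceAs (TopologicalSpace ((ℝ × ℚ_[2]) ⧸ diagonalDyadic))

instance : IsTopologicalAddGroup Solenoid :=
  inferInstanceAs (IsTopologicalAddGroup ((ℝ × ℚ_[2]) ⧸ diagonalDyadic))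

/-- The Borel `σ`-algebra. -/
instance : MeasurableSpace Solenoid := borel Solenoid

instance : BorelSpace Solenoid := ⟨rfl⟩

/-- The quotient homomorphism `(x, y) ↦ [x, y]`. -/
noncomputable def mk : ℝ × ℚ_[2] →+ Solenoid := QuotientAddGroup.mk' diagonalDyadic

theorem continuous_mk : Continuous mk := continuous_quotient_mk'

instance : CompactSpace Solenoid := by
  let g : ℝ × ℤ_[2] → Solenoid := fun a => mk (a.1, (a.2 : ℚ_[2]))
  have hg : Continuous g :=
    continuous_mk.comp (continuous_fst.prodMk (continuous_subtype_val.comp continuous_snd))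
  have hc : IsCompact (Set.Icc (0 : ℝ) 1 ×ˢ (Set.univ : Set ℤ_[2])) :=
    isCompact_Icc.prod isCompact_univ
  refine ⟨?_⟩
  convert hc.image hg
  symm
  rw [Set.eq_univ_iff_forall]
  rintro ⟨x, y⟩
  obtain ⟨r, -, ⟨k, N, rfl⟩, hr⟩ := exists_dyadic_fract y
  set x' : ℝ := x - k / 2 ^ N with hx'
  refine ⟨(Int.fract x', ⟨y - ((k / 2 ^ N : ℚ) : ℚ_[2]), hr⟩ - (⌊x'⌋ : ℤ_[2])),
    ⟨⟨Int.fract_nonneg _, (Int.fract_lt_one _).le⟩, Set.mem_univ _⟩, ?_⟩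
  refine QuotientAddGroup.eq.2 ⟨k + ⌊x'⌋ * 2 ^ N, N, ?_⟩
  ext
  · simp only [Int.fract, hx', Prod.fst_add, Prod.fst_neg]
    push_cast
    field_simp
    ring
  · change -((y - ((k / 2 ^ N : ℚ) : ℚ_[2])) - ((⌊x'⌋ : ℤ_[2]) : ℚ_[2])) + y = _
    rw [PadicInt.coe_intCast]
    push_cast
    field_simp
    ring

/-- The Haar probability measure `m_K`. -/
noncomputable def haar : Measure Solenoid := Measure.addHaarMeasure ⊤

/-- The automorphism `T[x, y] = [2x, 2y]`. -/
noncomputable def doubling : Solenoid ≃ₜ+ Solenoid where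
  toFun a := a + a
  invFun := QuotientAddGroup.lift diagonalDyadic
    (mk.comp (AddMonoidHom.prodMap (AddMonoidHom.mulLeft (2⁻¹ : ℝ))
      (AddMonoidHom.mulLeft (2⁻¹ : ℚ_[2])))) (by
      rintro _ ⟨k, N, rfl⟩
      refine (QuotientAddGroup.eq_zero_iff _).2 ⟨k, N + 1, ?_⟩
      ext
      · simp [pow_succ]
        field_simp
      · simp [pow_succ]
        field_simp)
  left_inv := by
    rintro ⟨x, y⟩
    refine congrArg mk (?_ : (2⁻¹ * (x + x), 2⁻¹ * (y + y)) = (x, y))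
    ext
    · simp only
      ring
    · simp only
      ring
  right_inv := by
    rintro ⟨x, y⟩
    refine congrArg mk (?_ : (2⁻¹ * x + 2⁻¹ * x, 2⁻¹ * y + 2⁻¹ * y) = (x, y))
    ext
    · simp only
      ring
    · simp only
      ring
  map_add' a b := add_add_add_comm a b a b
  continuous_toFun := continuous_id.add continuous_id
  continuous_invFun := by
    refine Continuous.quotient_lift (s := QuotientAddGroup.leftRel diagonalDyadic)
      (f := fun a : ℝ × ℚ_[2] => mk (2⁻¹ * a.1, 2⁻¹ * a.2)) ?_ _
    exact continuous_mk.comp (by fun_prop)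

theorem doubling_mk (x : ℝ) (y : ℚ_[2]) : doubling (mk (x, y)) = mk (2 * x, 2 * y) := by
  rw [two_mul, two_mul]
  rfl

/-- The projection `π : K → 𝕋 = ℝ/ℤ`, `π[x, y] = x - {y}₂ + ℤ`. -/
noncomputable def proj : Solenoid →+ UnitAddCircle :=
  QuotientAddGroup.lift diagonalDyadic
    (AddMonoidHom.mk' (fun a : ℝ × ℚ_[2] => ((a.1 - (twoAdicFract a.2 : ℝ) : ℝ) : UnitAddCircle))
      (by
        rintro ⟨x, y⟩ ⟨x', y'⟩
        obtain ⟨-, h1, h2⟩ := (exists_dyadic_fract y).choose_spec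
        obtain ⟨-, h1', h2'⟩ := (exists_dyadic_fract y').choose_spec
        obtain ⟨-, h1'', h2''⟩ := (exists_dyadic_fract (y + y')).choose_spec
        change ‖y - (twoAdicFract y : ℚ_[2])‖ ≤ 1 at h2
        change ‖y' - (twoAdicFract y' : ℚ_[2])‖ ≤ 1 at h2'
        change ‖y + y' - (twoAdicFract (y + y') : ℚ_[2])‖ ≤ 1 at h2''
        have key := coe_eq_of_norm_sub_le_one h1'' (dyadic_add h1 h1') (by
          change ‖(twoAdicFract (y + y') : ℚ_[2])
            - ((twoAdicFract y + twoAdicFract y' : ℚ) : ℚ_[2])‖ ≤ 1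
          have e : (twoAdicFract (y + y') : ℚ_[2])
              - ((twoAdicFract y + twoAdicFract y' : ℚ) : ℚ_[2])
              = ((y - (twoAdicFract y : ℚ_[2])) + (y' - (twoAdicFract y' : ℚ_[2])))
                - (y + y' - (twoAdicFract (y + y') : ℚ_[2])) := by
            push_cast
            ring
          rw [e]
          have t1 := Padic.nonarchimedean (y - (twoAdicFract y : ℚ_[2]))
            (y' - (twoAdicFract y' : ℚ_[2]))
          have t2 := Padic.nonarchimedean
            ((y - (twoAdicFract y : ℚ_[2])) + (y' - (twoAdicFract y' : ℚ_[2])))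
            (-(y + y' - (twoAdicFract (y + y') : ℚ_[2])))
          rw [norm_neg, ← sub_eq_add_neg] at t2
          exact t2.trans (max_le (t1.trans (max_le h2 h2')) h2''))
        change ((twoAdicFract (y + y') : ℝ) : UnitAddCircle)
          = ((twoAdicFract y + twoAdicFract y' : ℚ) : ℝ) at key
        change ((x + x' - (twoAdicFract (y + y') : ℝ) : ℝ) : UnitAddCircle)
          = ((x - (twoAdicFract y : ℝ) : ℝ) : UnitAddCircle)
            + ((x' - (twoAdicFract y' : ℝ) : ℝ) : UnitAddCircle)
        push_cast at key
        rw [AddCircle.coe_sub, key, AddCircle.coe_sub, AddCircle.coe_sub, AddCircle.coe_add,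
          AddCircle.coe_add]
        abel))
    (by
      rintro _ ⟨k, N, rfl⟩
      obtain ⟨-, h1, h2⟩ := (exists_dyadic_fract ((k : ℚ_[2]) / 2 ^ N)).choose_spec
      have key := coe_eq_of_norm_sub_le_one (r := k / 2 ^ N) ⟨k, N, rfl⟩ h1 (by
        push_cast
        exact h2)
      change (((k : ℝ) / 2 ^ N - (twoAdicFract ((k : ℚ_[2]) / 2 ^ N) : ℝ) : ℝ) : UnitAddCircle)
        = 0
      rw [AddCircle.coe_sub, sub_eq_zero]
      push_cast at key
      exact key)

theorem proj_mk (x : ℝ) (y : ℚ_[2]) :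
    proj (mk (x, y)) = ((x - (twoAdicFract y : ℝ) : ℝ) : UnitAddCircle) := rfl

/-- The set `B^(q) = π⁻¹(([0, 1/2] ∪ (q, 1)) + ℤ)`. -/
def windowSet (q : ℝ) : Set Solenoid :=
  proj ⁻¹' ((fun x : ℝ => (x : UnitAddCircle)) '' (Set.Icc 0 (1 / 2) ∪ Set.Ioo q 1))

/-- The automorphism `T` as a permutation of `K`. -/
noncomputable def doublingPerm : Equiv.Perm Solenoid := doubling.toEquiv

end Solenoid

/-! ### The solenoid and the ergodicity of its doubling map -/

/-! Take for `S` the dyadic rationals in `(1/2, 3/4]`. The window is the pullback under `proj` of a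
union of arcs, and `proj` intertwines `T` with the doubling map of the circle and carries Haar
measure to Lebesgue measure. The probabilistic estimates therefore take place on the circle, where
the centered indicator is the difference `step q - step (1/2)` of two centered arc indicators.

The key identity is `step_add_step_half`: the transfer operator of doubling sends `step a` to half
of `step (2 * a)`. Iterating it bounds the correlations at time `n` by a multiple of `2⁻ⁿ`, which
gives (i) for every `q` in the range.

If `q = k / 2 ^ N`, then `step (2 ^ n * q)` vanishes almost everywhere for `n ≥ N`. Gordin's
decomposition is then a finite sum: the window function equals `M + W ∘ T - W` with `W` bounded and
`M` antiperiodic under translation by `1/2` (`ae_step_sub_step_eq`). Since `M ∘ Tⁿ` is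
`1/2`-periodic for `n ≥ 1`, the functions `M ∘ Tⁿ` are pairwise orthogonal, so a sum of `m` of them
has second moment exactly `m ‖M‖²`. Moreover `M` is bounded below by `2 ^ (-N - 1)` on the arc `(0,
q - 1/2)`, hence `‖M‖² > 0` (`le_windowMartingale`).

A coboundary would have Birkhoff sums bounded in `L²`, contradicting this linear growth; that is
(ii). The number of points in `(-R, R)` differs from its approximate mean plus a sum of about `2R`
martingale differences by a bounded error, so the asymptotic number variance is `‖M‖²`; that is
(iv).

For (iii), `q ≤ 3/4` forces every orbit to re-enter the window one step after leaving it, which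
gives both syndeticity and the Meyer property. Ergodicity of `T` comes from contraction along the
dense image of `ℚ₂`, and it passes to the suspension by Fubini. -/

/-- The dyadic rationals are dense. -/
theorem exists_dyadic_between {a b : ℝ} (hab : a < b) :
    ∃ (k : ℤ) (N : ℕ), a < k / 2 ^ N ∧ (k : ℝ) / 2 ^ N < b := by
  obtain ⟨N, hN⟩ := exists_nat_gt (b - a)⁻¹
  have hpos : 0 < b - a := sub_pos.2 hab
  have h2N : (N : ℝ) < 2 ^ N := by exact_mod_cast Nat.lt_two_pow_self
  have h1 : 1 < (b - a) * 2 ^ N := by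
    rw [← inv_mul_lt_iff₀ hpos, mul_one]
    exact hN.trans h2N
  refine ⟨⌊a * 2 ^ N⌋ + 1, N, ?_, ?_⟩
  · rw [lt_div_iff₀ (by positivity)]
    push_cast
    exact Int.lt_floor_add_one _
  · rw [div_lt_iff₀ (by positivity)]
    push_cast
    linarith [Int.floor_le (a * 2 ^ N)]

namespace Solenoid

theorem isQuotientMap_mk : IsQuotientMap (mk : ℝ × ℚ_[2] → Solenoid) := isQuotientMap_quotient_mk'

theorem mk_surjective : Function.Surjective mk := isQuotientMap_mk.surjective

/-- The diagonal copy of `ℤ[1/2]` meets the unit box only in the origin. -/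
theorem eq_zero_of_mem_diagonalDyadic {v : ℝ × ℚ_[2]} (hv : v ∈ diagonalDyadic)
    (h1 : |v.1| < 1) (h2 : ‖v.2‖ ≤ 1) : v = 0 := by
  obtain ⟨k, N, rfl⟩ := hv
  obtain ⟨m, hm⟩ := exists_int_of_dyadic_norm_le_one k N h2
  simp only [hm] at h1
  have hm0 : m = 0 := by
    rw [← Int.abs_lt_one_iff]
    exact_mod_cast h1
  have hk : k = 0 := by
    rw [hm0, Int.cast_zero, div_eq_zero_iff] at hm
    rcases hm with h | h
    · exact_mod_cast h
    · exact absurd h (by positivity)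
  subst hk
  ext <;> simp

/-- Discreteness makes the subgroup closed, so the quotient is Hausdorff and, being compact and
second countable, Polish. This supplies the standard Borel structure required of the parameters. -/
instance : DiscreteTopology diagonalDyadic := by
  refine discreteTopology_of_isOpen_singleton_zero ?_
  have ho : IsOpen {v : ℝ × ℚ_[2] | |v.1| < 1 ∧ ‖v.2‖ < 1} :=
    (isOpen_lt (continuous_fst.abs) continuous_const).and
      (isOpen_lt continuous_snd.norm continuous_const)
  convert ho.preimage continuous_subtype_val (X := diagonalDyadic)
  ext v
  simp only [Set.mem_singleton_iff, Set.mem_preimage, Set.mem_ofPred_eq]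
  constructor
  · rintro rfl
    simp
  · rintro ⟨h1, h2⟩
    exact Subtype.ext (eq_zero_of_mem_diagonalDyadic v.2 h1 h2.le)

instance : IsClosed (diagonalDyadic : Set (ℝ × ℚ_[2])) := AddSubgroup.isClosed_of_discrete

instance : T3Space Solenoid := inferInstanceAs (T3Space ((ℝ × ℚ_[2]) ⧸ diagonalDyadic))

instance : SecondCountableTopology Solenoid :=
  inferInstanceAs (SecondCountableTopology ((ℝ × ℚ_[2]) ⧸ diagonalDyadic))

instance : PolishSpace Solenoid := by
  let _ := TopologicalSpace.metrizableSpaceMetric Solenoid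
  infer_instance

instance : Nonempty Solenoid := ⟨0⟩

instance : haar.IsAddHaarMeasure := inferInstanceAs (Measure.addHaarMeasure ⊤).IsAddHaarMeasure

instance : IsProbabilityMeasure haar := by
  refine ⟨?_⟩
  have := Measure.addHaarMeasure_self (K₀ := (⊤ : TopologicalSpace.PositiveCompacts Solenoid))
  simpa [haar] using this

/-- The fractional part of a `2`-adic integer is trivial modulo `1`. This removes the chosen
`twoAdicFract` near the origin, where continuity of `proj` is checked. -/
theorem proj_mk_of_norm_le_one (x : ℝ) {y : ℚ_[2]} (hy : ‖y‖ ≤ 1) : proj (mk (x, y)) = x := by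
  obtain ⟨-, h1, h2⟩ := (exists_dyadic_fract y).choose_spec
  have h3 : ‖((twoAdicFract y : ℚ) : ℚ_[2]) - ((0 : ℚ) : ℚ_[2])‖ ≤ 1 := by
    have e : ((twoAdicFract y : ℚ) : ℚ_[2]) - ((0 : ℚ) : ℚ_[2])
        = y + -(y - (twoAdicFract y : ℚ_[2])) := by
      push_cast
      ring
    rw [e]
    refine (Padic.nonarchimedean _ _).trans (max_le hy ?_)
    rw [norm_neg]
    exact h2
  have key := coe_eq_of_norm_sub_le_one (r := twoAdicFract y) h1 ⟨0, 0, by simp⟩ h3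
  rw [proj_mk, AddCircle.coe_sub, key]
  simp

theorem continuous_proj : Continuous proj := by
  rw [isQuotientMap_mk.continuous_iff]
  change Continuous (proj.comp mk)
  refine continuous_of_continuousAt_zero _ ?_
  have hev : ∀ᶠ v : ℝ × ℚ_[2] in 𝓝 0, ‖v.2‖ < 1 :=
    (isOpen_lt (by fun_prop) continuous_const).mem_nhds (by simp)
  have hc : Continuous fun v : ℝ × ℚ_[2] => ((v.1 : ℝ) : UnitAddCircle) :=
    (AddCircle.continuous_mk' (1 : ℝ)).comp continuous_fst
  refine hc.continuousAt.congr ?_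
  filter_upwards [hev] with v hv
  exact (proj_mk_of_norm_le_one v.1 hv.le).symm

theorem proj_surjective : Function.Surjective proj := by
  intro t
  obtain ⟨x, rfl⟩ := QuotientAddGroup.mk_surjective t
  exact ⟨mk (x, 0), proj_mk_of_norm_le_one x (by simp)⟩

/-- A continuous surjective homomorphism of compact groups pushes Haar measure to Haar measure;
equal total masses fix the constant. -/
theorem measurePreserving_proj : MeasurePreserving proj haar volume :=
  AddMonoidHom.measurePreserving continuous_proj proj_surjective (by simp)

theorem measurePreserving_doubling : MeasurePreserving doubling haar haar :=
  AddMonoidHom.measurePreserving (f := doubling.toAddMonoidHom) doubling.continuous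
    doubling.surjective rfl

theorem proj_doubling (a : Solenoid) : proj (doubling a) = proj a + proj a := proj.map_add a a

/-! ### Contraction along `ℚ₂` and ergodicity -/

theorem doubling_iterate_mk (n : ℕ) (x : ℝ) (y : ℚ_[2]) :
    doubling^[n] (mk (x, y)) = mk (2 ^ n * x, 2 ^ n * y) := by
  induction n with
  | zero => simp
  | succ n ih => rw [Function.iterate_succ_apply', ih, doubling_mk, pow_succ', pow_succ', mul_assoc, mul_assoc]

/-- Since `|2|₂ < 1`, the image of `ℚ₂` is contracted to `0` by the doubling map. -/
theorem tendsto_doubling_iterate_mk_zero (y : ℚ_[2]) :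
    Tendsto (fun n => doubling^[n] (mk (0, y))) atTop (𝓝 0) := by
  have h2 : ‖(2 : ℚ_[2])‖ < 1 := by
    have := Padic.norm_p (p := 2)
    norm_num at this
    rw [this]
    norm_num
  have h : Tendsto (fun n : ℕ => ((0 : ℝ), (2 : ℚ_[2]) ^ n * y)) atTop (𝓝 0) := by
    refine tendsto_const_nhds.prodMk_nhds ?_
    simpa using (tendsto_pow_atTop_nhds_zero_of_norm_lt_one h2).mul_const y
  have h' := (continuous_mk.tendsto 0).comp h
  rw [map_zero] at h'
  refine h'.congr fun n => ?_
  simp [doubling_iterate_mk]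

/-- The image of `ℚ₂` is dense in the solenoid. -/
theorem dense_range_mk_zero : Dense (Set.range fun y : ℚ_[2] => mk (0, y)) := by
  have hden : Dense {v : ℝ × ℚ_[2] | ∃ (k : ℤ) (N : ℕ), v.1 = k / 2 ^ N} := by
    have hd : Dense {x : ℝ | ∃ (k : ℤ) (N : ℕ), x = k / 2 ^ N} := by
      refine dense_of_exists_between fun a b hab => ?_
      obtain ⟨k, N, h1, h2⟩ := exists_dyadic_between hab
      exact ⟨_, ⟨k, N, rfl⟩, h1, h2⟩
    exact hd.preimage isOpenMap_fst
  refine (mk_surjective.denseRange.dense_image continuous_mk hden).mono ?_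
  rintro _ ⟨⟨x, y⟩, ⟨k, N, hx⟩, rfl⟩
  -- Subtracting the diagonal element `k / 2 ^ N` moves a point with dyadic real coordinate into the
  -- image of `ℚ₂`.
  refine ⟨y - k / 2 ^ N, ?_⟩
  refine QuotientAddGroup.eq.2 ⟨k, N, ?_⟩
  simp only at hx
  ext
  · simp [hx]
  · simp

/-- `Tⁿ` is a measure-preserving homomorphism fixing `s`, so it pulls the translate of `s` by `Tⁿ w`
back to the translate by `w`. -/
theorem haar_symmDiff_iterate {s : Set Solenoid} (hs : MeasurableSet s)
    (hinv : doubling ⁻¹' s = s) (w : Solenoid) (n : ℕ) :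
    haar (symmDiff ((fun a => doubling^[n] w + a) ⁻¹' s) s)
      = haar (symmDiff ((fun a => w + a) ⁻¹' s) s) := by
  have hinvn : doubling^[n] ⁻¹' s = s := by
    rw [Set.preimage_iterate_eq, Function.iterate_fixed hinv]
  have hadd : ∀ a, doubling^[n] (w + a) = doubling^[n] w + doubling^[n] a :=
    iterate_map_add doubling n w
  have hpre : doubling^[n] ⁻¹' (symmDiff ((fun a => doubling^[n] w + a) ⁻¹' s) s)
      = symmDiff ((fun a => w + a) ⁻¹' s) s := by
    have h1 : ∀ a, doubling^[n] a ∈ s ↔ a ∈ s := fun a => Set.ext_iff.1 hinvn a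
    ext a
    simp only [Set.mem_preimage, Set.mem_symmDiff, ← hadd, h1]
  have hm : MeasurableSet (symmDiff ((fun a => doubling^[n] w + a) ⁻¹' s) s) :=
    (hs.preimage (measurable_const_add _)).symmDiff hs
  rw [← hpre, (measurePreserving_doubling.iterate n).measure_preimage hm.nullMeasurableSet]

/-- A Hopf-type argument. For `w` in the image of `ℚ₂`, the defect of invariance of `s` under `w`
equals the defect under `Tⁿ w → 0`, which tends to `0` by continuity of translation in measure. Thus
`s` is almost invariant under a dense set of translations, hence trivial. -/
theorem ergodic_doubling : Ergodic doubling haar := by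
  refine ⟨measurePreserving_doubling, ⟨fun s hs hinv => ?_⟩⟩
  refine aeconst_of_dense_setOfPred_preimage_vadd_ae (M := Solenoid) hs.nullMeasurableSet
    (dense_range_mk_zero.mono ?_)
  rintro _ ⟨y, rfl⟩
  let f : C(Solenoid × Solenoid, Solenoid) := ⟨fun v => v.1 + v.2, continuous_add⟩
  have hf : ∀ v, MeasurePreserving (f.curry v) haar haar := fun v =>
    measurePreserving_add_left haar v
  have ht := tendsto_measure_symmDiff_preimage_nhds_zero (μ := haar) (ν := haar) (s := s)
    ((f.curry.continuous.tendsto 0).comp (tendsto_doubling_iterate_mk_zero y))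
    (.of_forall fun n => hf _) (hf 0) hs.nullMeasurableSet (measure_ne_top _ _)
  have h0 : f.curry 0 ⁻¹' s = s := by
    ext a
    simp [f]
  rw [h0] at ht
  have hz := tendsto_nhds_unique (ht.congr fun n => haar_symmDiff_iterate hs hinv (mk (0, y)) n)
    tendsto_const_nhds
  exact measure_symmDiff_eq_zero_iff.1 hz.symm

end Solenoid

/-! ### Step functions on the circle and the doubling map -/

namespace UnitAddCircle

instance : IsProbabilityMeasure (volume : Measure UnitAddCircle) :=
  ⟨UnitAddCircle.measure_univ⟩

/-- The representative in `[0, 1)`. -/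
noncomputable def rep (x : UnitAddCircle) : ℝ := AddCircle.equivIco 1 0 x

theorem rep_coe (x : ℝ) : rep (x : UnitAddCircle) = Int.fract x := by
  have h := AddCircle.coe_equivIco_mk_apply (1 : ℝ) x
  rw [div_one, mul_one] at h
  exact h

theorem coe_rep (x : UnitAddCircle) : (rep x : UnitAddCircle) = x := AddCircle.coe_equivIco

theorem rep_nonneg (x : UnitAddCircle) : 0 ≤ rep x := (AddCircle.equivIco 1 0 x).2.1

theorem rep_lt_one (x : UnitAddCircle) : rep x < 1 :=
  (AddCircle.equivIco (1 : ℝ) 0 x).2.2.trans_eq (zero_add 1)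

theorem measurable_rep : Measurable rep :=
  measurable_subtype_coe.comp (AddCircle.measurableEquivIco 1 0).measurable

theorem add_half_add_half (x : UnitAddCircle) :
    x + ((1 / 2 : ℝ) : UnitAddCircle) + ((1 / 2 : ℝ) : UnitAddCircle) = x := by
  rw [add_assoc, ← AddCircle.coe_add, add_halves, AddCircle.coe_period, add_zero]

theorem rep_add_self (x : UnitAddCircle) :
    rep (x + x) = if rep x < 1 / 2 then 2 * rep x else 2 * rep x - 1 := by
  have h0 := rep_nonneg x
  have h1 := rep_lt_one x
  conv_lhs => rw [← coe_rep x, ← AddCircle.coe_add, rep_coe]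
  split_ifs with h
  · rw [Int.fract_eq_iff]
    exact ⟨by linarith, by linarith, 0, by push_cast; ring⟩
  · rw [Int.fract_eq_iff]
    exact ⟨by linarith, by linarith, 1, by push_cast; ring⟩

theorem rep_add_half (x : UnitAddCircle) :
    rep (x + ((1 / 2 : ℝ) : UnitAddCircle))
      = if rep x < 1 / 2 then rep x + 1 / 2 else rep x - 1 / 2 := by
  have h0 := rep_nonneg x
  have h1 := rep_lt_one x
  conv_lhs => rw [← coe_rep x, ← AddCircle.coe_add, rep_coe]
  split_ifs with h
  · rw [Int.fract_eq_iff]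
    exact ⟨by linarith, by linarith, 0, by push_cast; ring⟩
  · rw [Int.fract_eq_iff]
    exact ⟨by linarith, by linarith, 1, by push_cast; ring⟩

theorem fract_two_mul (a : ℝ) : Int.fract (2 * a)
    = if Int.fract a < 1 / 2 then 2 * Int.fract a else 2 * Int.fract a - 1 := by
  rw [← rep_coe (2 * a), two_mul, AddCircle.coe_add, rep_add_self, rep_coe]

/-- The centered indicator of the arc from `a` to `1`. -/
noncomputable def step (a : ℝ) (x : UnitAddCircle) : ℝ :=
  (if Int.fract a < rep x then 1 else 0) - (1 - Int.fract a)

theorem measurable_step (a : ℝ) : Measurable (step a) :=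
  (Measurable.ite (measurableSet_lt measurable_const measurable_rep) measurable_const
    measurable_const).sub measurable_const

theorem abs_step_le (a : ℝ) (x : UnitAddCircle) : |step a x| ≤ 1 := by
  have h0 := Int.fract_nonneg a
  have h1 := Int.fract_lt_one a
  unfold step
  split_ifs <;> rw [abs_le] <;> constructor <;> linarith

/-- The transfer operator of the doubling map halves and doubles the parameter of a step. -/
theorem step_add_step_half (a : ℝ) (x : UnitAddCircle) :
    step a x + step a (x + ((1 / 2 : ℝ) : UnitAddCircle)) = step (2 * a) (x + x) := by
  have h0 := Int.fract_nonneg a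
  have h1 := Int.fract_lt_one a
  have h2 := rep_nonneg x
  have h3 := rep_lt_one x
  unfold step
  rw [rep_add_self, rep_add_half, fract_two_mul]
  split_ifs <;> linarith

theorem volume_lt_rep {a : ℝ} (h0 : 0 ≤ a) (h1 : a ≤ 1) :
    volume.real {x : UnitAddCircle | a < rep x} = 1 - a := by
  rw [measureReal_def, AddCircle.add_projection_respects_measure 1 0
    (measurableSet_lt measurable_const measurable_rep)]
  have : QuotientAddGroup.mk ⁻¹' {x : UnitAddCircle | a < rep x} ∩ Set.Ioc (0 : ℝ) (0 + 1)
      = Set.Ioo a 1 := by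
    ext x
    simp only [Set.mem_inter_iff, Set.mem_preimage, Set.mem_ofPred_eq, Set.mem_Ioc, Set.mem_Ioo]
    rw [rep_coe, zero_add]
    constructor
    · rintro ⟨h, hx0, hx1⟩
      rcases hx1.lt_or_eq with hx | rfl
      · rw [Int.fract_eq_self.2 ⟨hx0.le, hx⟩] at h
        exact ⟨h, hx⟩
      · rw [Int.fract_one] at h
        linarith
    · rintro ⟨h, hx⟩
      rw [Int.fract_eq_self.2 ⟨by linarith, hx⟩]
      exact ⟨h, by linarith, hx.le⟩
  rw [this, Real.volume_Ioo, ENNReal.toReal_ofReal (by linarith)]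

theorem ae_rep_ne_zero : ∀ᵐ x : UnitAddCircle, rep x ≠ 0 := by
  have h := volume_lt_rep (a := 0) le_rfl zero_le_one
  have hm : MeasurableSet {x : UnitAddCircle | 0 < rep x} :=
    measurableSet_lt measurable_const measurable_rep
  have h' : volume {x : UnitAddCircle | 0 < rep x} = 1 := by
    rw [measureReal_def] at h
    rw [← ENNReal.ofReal_toReal (measure_ne_top volume {x : UnitAddCircle | 0 < rep x}), h]
    simp
  have := (prob_compl_eq_zero_iff hm).2 h'
  filter_upwards [measure_eq_zero_iff_ae_notMem.1 this] with x hx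
  simp only [Set.mem_compl_iff, Set.mem_ofPred_eq, not_not] at hx
  exact hx.ne'

theorem integrable_of_bounded {α : Type*} [MeasurableSpace α] {μ : Measure α} [IsFiniteMeasure μ]
    {f : α → ℝ} (hf : Measurable f) {C : ℝ} (h : ∀ x, |f x| ≤ C) : Integrable f μ :=
  .of_bound hf.aestronglyMeasurable C (.of_forall h)

theorem integral_step (a : ℝ) : ∫ x, step a x = 0 := by
  have hm : MeasurableSet {x : UnitAddCircle | Int.fract a < rep x} :=
    measurableSet_lt measurable_const measurable_rep
  have e : step a = fun x => {x : UnitAddCircle | Int.fract a < rep x}.indicator (fun _ => (1 : ℝ)) x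
      - (1 - Int.fract a) := by
    ext x
    simp [step, Set.indicator_apply]
  rw [e, integral_sub ((integrable_const _).indicator hm) (integrable_const _),
    integral_indicator_const _ hm, volume_lt_rep (Int.fract_nonneg a) (Int.fract_lt_one a).le]
  simp

/-- For an integer parameter the arc is the whole circle minus the point `0`, where the value is
`-1`; hence only almost everywhere. This is what terminates the expansion for dyadic `q`. -/
theorem step_intCast_ae_eq_zero (k : ℤ) : step k =ᵐ[volume] 0 := by
  filter_upwards [ae_rep_ne_zero] with x hx
  simp [step, (rep_nonneg x).lt_of_ne' hx]

/-! ### The transfer operator of the doubling map -/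

theorem measurePreserving_double : MeasurePreserving (fun x : UnitAddCircle => x + x) := by
  have := (AddCircle.ergodic_nsmul (T := 1) one_lt_two).toMeasurePreserving
  simpa only [two_nsmul] using this

/-- Translation by `c` turns the integral into its negative. With `c = 1/2` this is the
orthogonality of the kernel of the transfer operator to functions of `2x`. -/
theorem integral_antiperiodic_mul {M ψ : UnitAddCircle → ℝ} {c : UnitAddCircle}
    (hM : ∀ x, M (x + c) = -M x) (hψ : ∀ x, ψ (x + c) = ψ x) : ∫ x, M x * ψ x = 0 := by
  have h := integral_add_right_eq_self (μ := (volume : Measure UnitAddCircle))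
    (fun x => M x * ψ x) c
  simp only [hM, hψ, neg_mul, integral_neg] at h
  linarith

/-- Since `ψ (x + x)` is `1/2`-periodic, `step a` may be averaged over the two preimages of `x + x`;
the average is half of `step (2 * a)` at `x + x`. -/
theorem integral_step_mul_double (a : ℝ) {ψ : UnitAddCircle → ℝ} (hψ : Measurable ψ) {C : ℝ}
    (hC : ∀ x, |ψ x| ≤ C) :
    ∫ x, step a x * ψ (x + x) = 2⁻¹ * ∫ x, step (2 * a) x * ψ x := by
  set c : UnitAddCircle := ((1 / 2 : ℝ) : UnitAddCircle) with hc
  have hshift : ∀ x, ψ (x + c + (x + c)) = ψ (x + x) := fun x => by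
    rw [add_add_add_comm, ← AddCircle.coe_add, add_halves, AddCircle.coe_period, add_zero]
  have h1 : ∫ x, step a (x + c) * ψ (x + x) = ∫ x, step a x * ψ (x + x) := by
    have h := integral_add_right_eq_self (μ := (volume : Measure UnitAddCircle))
      (fun x => step a x * ψ (x + x)) c
    simpa only [hshift] using h
  have hmeas : Measurable fun x : UnitAddCircle => ψ (x + x) :=
    hψ.comp (measurable_id.add measurable_id)
  have hb : ∀ s t : ℝ, |s| ≤ 1 → |t| ≤ C → |s * t| ≤ C := fun s t hs ht => by
    rw [abs_mul]
    nlinarith [abs_nonneg s, abs_nonneg t]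
  have hi1 : Integrable fun x => step a x * ψ (x + x) :=
    integrable_of_bounded ((measurable_step a).mul hmeas) fun x => hb _ _ (abs_step_le a x) (hC _)
  have hi2 : Integrable fun x => step a (x + c) * ψ (x + x) :=
    integrable_of_bounded (((measurable_step a).comp (measurable_id.add_const c)).mul hmeas)
      fun x => hb _ _ (abs_step_le a _) (hC _)
  have h2 : ∫ x, step (2 * a) (x + x) * ψ (x + x) = ∫ x, step (2 * a) x * ψ x := by
    have hm : Measurable fun x => step (2 * a) x * ψ x := (measurable_step _).mul hψ
    conv_rhs => rw [← measurePreserving_double.map_eq]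
    rw [integral_map measurePreserving_double.measurable.aemeasurable hm.aestronglyMeasurable]
  rw [← h2]
  simp only [← step_add_step_half, add_mul]
  rw [integral_add hi1 hi2, h1]
  ring

theorem integral_step_mul_pow (n : ℕ) (a : ℝ) {ψ : UnitAddCircle → ℝ} (hψ : Measurable ψ) {C : ℝ}
    (hC : ∀ x, |ψ x| ≤ C) :
    ∫ x, step a x * ψ (2 ^ n • x) = (2⁻¹) ^ n * ∫ x, step (2 ^ n * a) x * ψ x := by
  induction n generalizing a with
  | zero => simp
  | succ n ih =>
    have e : ∀ x : UnitAddCircle, 2 ^ (n + 1) • x = 2 ^ n • (x + x) := fun x => by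
      rw [pow_succ, mul_nsmul', two_nsmul]
    simp only [e]
    rw [integral_step_mul_double a (ψ := fun x => ψ (2 ^ n • x))
      (hψ.comp (measurable_const_smul _)) (fun x => hC _), ih]
    rw [pow_succ, pow_succ]
    ring_nf

/-! ### The martingale-coboundary decomposition -/

/-- The part of `step a` which the transfer operator of the doubling map annihilates. -/
noncomputable def stepDiff (a : ℝ) (x : UnitAddCircle) : ℝ :=
  (step a x - step a (x + ((1 / 2 : ℝ) : UnitAddCircle))) / 2

theorem step_eq (a : ℝ) (x : UnitAddCircle) :
    step a x = stepDiff a x + 2⁻¹ * step (2 * a) (x + x) := by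
  rw [← step_add_step_half, stepDiff]
  ring

theorem stepDiff_add_half (a : ℝ) (x : UnitAddCircle) :
    stepDiff a (x + ((1 / 2 : ℝ) : UnitAddCircle)) = -stepDiff a x := by
  rw [stepDiff, stepDiff, add_half_add_half]
  ring

theorem measurable_stepDiff (a : ℝ) : Measurable (stepDiff a) :=
  ((measurable_step a).sub ((measurable_step a).comp (measurable_id.add_const _))).div_const 2

theorem abs_stepDiff_le (a : ℝ) (x : UnitAddCircle) : |stepDiff a x| ≤ 1 := by
  have h1 := abs_le.1 (abs_step_le a x)
  have h2 := abs_le.1 (abs_step_le a (x + ((1 / 2 : ℝ) : UnitAddCircle)))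
  rw [stepDiff, abs_le]
  constructor <;> linarith

/-- The centering constants cancel, leaving half a difference of indicators. The sharp constant
`1/2` is needed for the positivity in `le_windowMartingale`. -/
theorem neg_half_le_stepDiff (a : ℝ) {x : UnitAddCircle} : -(1 / 2) ≤ stepDiff a x := by
  rw [stepDiff, step, step]
  split_ifs <;> linarith

theorem stepDiff_eq_zero {a : ℝ} {x : UnitAddCircle} (ha : 1 / 2 < a) (ha1 : a < 1)
    (hx : rep x < a - 1 / 2) : stepDiff a x = 0 := by
  have hf : Int.fract a = a := Int.fract_eq_self.2 ⟨by linarith, ha1⟩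
  rw [stepDiff, step, step, rep_add_half, hf]
  split_ifs <;> linarith

theorem stepDiff_half {x : UnitAddCircle} (h0 : 0 < rep x) (hx : rep x < 1 / 2) :
    stepDiff (1 / 2) x = -(1 / 2) := by
  have hf : Int.fract (1 / 2 : ℝ) = 1 / 2 := Int.fract_eq_self.2 ⟨by norm_num, by norm_num⟩
  rw [stepDiff, step, step, rep_add_half, hf]
  split_ifs <;> linarith

/-- Put `h k = 2⁻ᵏ step (2ᵏ q)`. By `step_eq`, `h k` is its antiperiodic part plus `h (k + 1)`
composed with doubling; sum the differences `h k - h (k + 1)` over `k < N`. -/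
theorem sum_step_telescope (q : ℝ) (N : ℕ) (x : UnitAddCircle) :
    step q x = ∑ k ∈ Finset.range N, (2⁻¹) ^ k * stepDiff (2 ^ k * q) x
      + ∑ k ∈ Finset.range N, (2⁻¹) ^ (k + 1) * step (2 ^ (k + 1) * q) (x + x)
      - ∑ k ∈ Finset.range N, (2⁻¹) ^ (k + 1) * step (2 ^ (k + 1) * q) x
      + (2⁻¹) ^ N * step (2 ^ N * q) x := by
  induction N with
  | zero => simp
  | succ N ih =>
    rw [Finset.sum_range_succ, Finset.sum_range_succ, Finset.sum_range_succ]
    have h := step_eq (2 ^ N * q) x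
    rw [show 2 * (2 ^ N * q) = 2 ^ (N + 1) * q by ring] at h
    rw [h] at ih
    rw [ih, pow_succ]
    ring

theorem sum_geometric_le {g : ℕ → ℝ} (e : ℕ → ℕ) (n : ℕ) (hg : ∀ k, |g k| ≤ 1) :
    |∑ k ∈ Finset.range n, (2⁻¹ : ℝ) ^ e k * g k| ≤ n := by
  refine (Finset.abs_sum_le_sum_abs _ _).trans ?_
  have : ∀ k ∈ Finset.range n, |(2⁻¹ : ℝ) ^ e k * g k| ≤ 1 := fun k _ => by
    rw [abs_mul, abs_of_nonneg (by positivity)]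
    exact mul_le_one₀ (pow_le_one₀ (by norm_num) (by norm_num)) (abs_nonneg _) (hg k)
  simpa using Finset.sum_le_sum this

/-- A martingale difference for the doubling map, cohomologous to the centered window function. -/
noncomputable def windowMartingale (q : ℝ) (N : ℕ) (x : UnitAddCircle) : ℝ :=
  ∑ k ∈ Finset.range (N + 1), (2⁻¹) ^ k * stepDiff (2 ^ k * q) x - stepDiff (1 / 2) x

/-- The transfer function between the window function and `windowMartingale`. -/
noncomputable def windowTransfer (q : ℝ) (N : ℕ) (x : UnitAddCircle) : ℝ :=
  ∑ k ∈ Finset.range (N + 1), (2⁻¹) ^ (k + 1) * step (2 ^ (k + 1) * q) x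

theorem measurable_windowMartingale (q : ℝ) (N : ℕ) : Measurable (windowMartingale q N) :=
  (Finset.measurable_fun_sum _ fun k _ => (measurable_stepDiff (2 ^ k * q)).const_mul _).sub
    (measurable_stepDiff _)

theorem abs_windowMartingale_le (q : ℝ) (N : ℕ) (x : UnitAddCircle) :
    |windowMartingale q N x| ≤ N + 2 := by
  have h1 := sum_geometric_le id (N + 1) fun k => abs_stepDiff_le (2 ^ k * q) x
  have h2 := abs_stepDiff_le (1 / 2) x
  have h3 := abs_sub (∑ k ∈ Finset.range (N + 1), (2⁻¹) ^ k * stepDiff (2 ^ k * q) x)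
    (stepDiff (1 / 2) x)
  simp only [id] at h1
  push_cast at h1
  rw [windowMartingale]
  linarith

theorem abs_windowTransfer_le (q : ℝ) (N : ℕ) (x : UnitAddCircle) :
    |windowTransfer q N x| ≤ N + 2 := by
  have h1 := sum_geometric_le (· + 1) (N + 1) fun k => abs_step_le (2 ^ (k + 1) * q) x
  push_cast at h1
  rw [windowTransfer]
  linarith

theorem windowMartingale_add_half (q : ℝ) (N : ℕ) (x : UnitAddCircle) :
    windowMartingale q N (x + ((1 / 2 : ℝ) : UnitAddCircle)) = -windowMartingale q N x := by
  simp only [windowMartingale, stepDiff_add_half, mul_neg, Finset.sum_neg_distrib]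
  ring

theorem neg_half_mul_le_sum_stepDiff (q : ℝ) (n : ℕ) (x : UnitAddCircle) :
    -(1 / 2) * (1 - (2⁻¹ : ℝ) ^ n)
      ≤ ∑ k ∈ Finset.range n, (2⁻¹) ^ (k + 1) * stepDiff (2 ^ (k + 1) * q) x := by
  induction n with
  | zero => simp
  | succ n ih =>
    rw [Finset.sum_range_succ]
    have h1 := neg_half_le_stepDiff (2 ^ (n + 1) * q) (x := x)
    have h2 : (0 : ℝ) ≤ (2⁻¹) ^ (n + 1) := by positivity
    have h3 := mul_le_mul_of_nonneg_left h1 h2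
    have h4 : (2⁻¹ : ℝ) ^ n = 2 * (2⁻¹) ^ (n + 1) := by
      rw [pow_succ]
      ring
    linarith

/-- On this arc the term `k = 0` vanishes and `-stepDiff (1 / 2)` contributes `1/2`. The remaining
terms lose at most `(1 - 2⁻ᴺ) / 2`, so a positive amount survives. -/
theorem le_windowMartingale {q : ℝ} (hq : 1 / 2 < q) (hq1 : q < 1) (N : ℕ) {x : UnitAddCircle}
    (h0 : 0 < rep x) (hx : rep x < q - 1 / 2) :
    2⁻¹ * (2⁻¹) ^ N ≤ windowMartingale q N x := by
  rw [windowMartingale, Finset.sum_range_succ', stepDiff_half h0 (by linarith)]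
  simp only [pow_zero, one_mul]
  rw [stepDiff_eq_zero hq hq1 hx]
  linarith [neg_half_mul_le_sum_stepDiff q N x]

theorem volume_rep_pos {b : ℝ} (hb : 0 < b) (hb1 : b < 1) :
    0 < volume {x : UnitAddCircle | 0 < rep x ∧ rep x < b} := by
  have h1 := volume_lt_rep (a := 0) le_rfl zero_le_one
  have h2 := volume_lt_rep (a := b / 2) (by linarith) (by linarith)
  rw [pos_iff_ne_zero]
  intro h
  have hsub : {x : UnitAddCircle | 0 < rep x}
      ⊆ {x | 0 < rep x ∧ rep x < b} ∪ {x | b / 2 < rep x} := by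
    intro x hx
    simp only [Set.mem_ofPred_eq, Set.mem_union] at hx ⊢
    by_cases h : rep x < b
    · exact Or.inl ⟨hx, h⟩
    · exact Or.inr (by linarith)
  have h3 := (measureReal_mono (μ := (volume : Measure UnitAddCircle)) hsub
    (measure_ne_top _ _)).trans (measureReal_union_le _ _)
  rw [h1, h2, measureReal_def, h] at h3
  simp only [ENNReal.toReal_zero] at h3
  linarith

theorem integral_windowMartingale_sq_pos {q : ℝ} (hq : 1 / 2 < q) (hq1 : q < 1) (N : ℕ) :
    0 < ∫ x, windowMartingale q N x ^ 2 := by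
  have hint : Integrable fun x => windowMartingale q N x ^ 2 :=
    integrable_of_bounded ((measurable_windowMartingale q N).pow_const 2) (C := (N + 2) ^ 2)
      fun x => by
        rw [abs_pow]
        exact pow_le_pow_left₀ (abs_nonneg _) (abs_windowMartingale_le q N x) 2
  rw [integral_pos_iff_support_of_nonneg (fun x => sq_nonneg _) hint]
  have hpos : (0 : ℝ) < 2⁻¹ * (2⁻¹) ^ N := by positivity
  refine (volume_rep_pos (b := q - 1 / 2) (by linarith) (by linarith)).trans_le
    (measure_mono fun x hx => ?_)
  exact Function.mem_support.2
    (pow_pos (hpos.trans_le (le_windowMartingale hq hq1 N hx.1 hx.2)) 2).ne'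

theorem step_intCast_double_ae_eq_zero (k : ℤ) : ∀ᵐ x : UnitAddCircle, step k (x + x) = 0 := by
  have h := measurePreserving_double.quasiMeasurePreserving.ae_eq_comp (step_intCast_ae_eq_zero k)
  filter_upwards [h] with x hx
  simpa using hx

/-- For a dyadic endpoint, the centered window function is cohomologous to a martingale
difference for the doubling map. -/
theorem ae_step_sub_step_eq {q : ℝ} {k : ℤ} {N : ℕ} (hk : q = k / 2 ^ N) :
    ∀ᵐ x, step q x - step (1 / 2) x
      = windowMartingale q N x + windowTransfer q N (x + x) - windowTransfer q N x := by
  -- The sums have `N + 1` terms, so the remainder is a multiple of `step (2 ^ (N + 1) * q)`, whose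
  -- parameter is the integer `2 * k`.
  have h1 := step_intCast_ae_eq_zero (2 * k)
  have hq : ((2 * k : ℤ) : ℝ) = 2 ^ (N + 1) * q := by
    rw [hk, pow_succ]
    push_cast
    field_simp
  rw [hq] at h1
  filter_upwards [h1, step_intCast_double_ae_eq_zero 1] with x hx1 hx2
  have e1 := sum_step_telescope q (N + 1) x
  -- For the endpoint `1/2` one application suffices, because its double is already the integer `1`.
  have e2 := step_eq (1 / 2) x
  rw [show (2 : ℝ) * (1 / 2) = (1 : ℤ) by norm_num, hx2] at e2
  rw [hx1] at e1
  simp only [Pi.zero_apply, mul_zero, add_zero] at e1 e2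
  simp only [windowMartingale, windowTransfer]
  linarith

end UnitAddCircle

/-! ### The window and its Birkhoff sums -/

theorem Finset.sum_Ico_add_natCast {E : Type*} [AddCommMonoid E] (f : ℤ → E) (α : ℤ) (k : ℕ) :
    ∑ n ∈ Finset.Ico α (α + k), f n = ∑ i ∈ Finset.range k, f (α + i) := by
  induction k with
  | zero => simp
  | succ k ih =>
    have : Finset.Ico α (α + (k + 1 : ℕ)) = insert (α + k) (Finset.Ico α (α + k)) := by
      ext n
      simp only [Finset.mem_Ico, Finset.mem_insert]
      omega
    rw [this, Finset.sum_insert (by simp), Finset.sum_range_succ, ih, add_comm]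

theorem MeasureTheory.MeasurePreserving.integral_comp_of_aestronglyMeasurable {α β : Type*}
    [MeasurableSpace α] [MeasurableSpace β] {μ : Measure α} {ν : Measure β} {T : α → β}
    (hT : MeasurePreserving T μ ν) {g : β → ℝ} (hg : AEStronglyMeasurable g ν) :
    ∫ a, g (T a) ∂μ = ∫ b, g b ∂ν := by
  rw [← hT.map_eq, integral_map hT.measurable.aemeasurable (by rwa [hT.map_eq])]

namespace Solenoid

open UnitAddCircle

theorem proj_doublingPerm (a : Solenoid) : proj (doublingPerm a) = proj a + proj a :=
  proj_doubling a

theorem proj_doublingPerm_pow (n : ℕ) (a : Solenoid) :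
    proj ((doublingPerm ^ n) a) = 2 ^ n • proj a := by
  induction n with
  | zero => simp
  | succ n ih =>
    rw [pow_succ', Equiv.Perm.mul_apply, proj_doublingPerm, ih, pow_succ, mul_nsmul, two_nsmul]

theorem measurePreserving_doublingPerm : MeasurePreserving doublingPerm haar haar :=
  measurePreserving_doubling

theorem measurable_doublingPerm_symm : Measurable doublingPerm.symm :=
  doubling.symm.continuous.measurable

theorem measurePreserving_doublingPerm_symm : MeasurePreserving doublingPerm.symm haar haar :=
  MeasurePreserving.symm (e := doubling.toHomeomorph.toMeasurableEquiv) measurePreserving_doubling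

theorem measurePreserving_doublingPerm_pow (n : ℕ) :
    MeasurePreserving (doublingPerm ^ n) haar haar := by
  have h := measurePreserving_doublingPerm.iterate n
  rwa [Equiv.Perm.iterate_eq_pow] at h

theorem measurePreserving_doublingPerm_zpow (n : ℤ) :
    MeasurePreserving (doublingPerm ^ n) haar haar := by
  obtain ⟨m, rfl | rfl⟩ := n.eq_nat_or_neg
  · exact_mod_cast measurePreserving_doublingPerm_pow m
  · have h := measurePreserving_doublingPerm_symm.iterate m
    rw [Equiv.Perm.iterate_eq_pow] at h
    rw [zpow_neg, zpow_natCast, ← inv_pow]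
    exact h

theorem measurable_doublingPerm_zpow (n : ℤ) : Measurable (doublingPerm ^ n) :=
  (measurePreserving_doublingPerm_zpow n).measurable

/-- The set of points of `K` satisfying a full-measure condition along their whole orbit. -/
theorem ae_forall_zpow {p : Solenoid → Prop} (hp : ∀ᵐ a ∂haar, p a) :
    ∀ᵐ a ∂haar, ∀ n : ℤ, p ((doublingPerm ^ n) a) :=
  ae_all_iff.2 fun n =>
    (measurePreserving_doublingPerm_zpow n).quasiMeasurePreserving.tendsto_ae.eventually hp

variable {q : ℝ}

theorem mem_windowSet (hq : 1 / 2 < q) {a : Solenoid} :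
    a ∈ windowSet q ↔ rep (proj a) ≤ 1 / 2 ∨ q < rep (proj a) := by
  have h0 := rep_nonneg (proj a)
  have h1 := rep_lt_one (proj a)
  change proj a ∈ _ '' _ ↔ _
  constructor
  · rintro ⟨x, hx, hxa⟩
    have hx' : rep (proj a) = x := by
      rw [← hxa, rep_coe, Int.fract_eq_self]
      rcases hx with hx | hx
      · exact ⟨hx.1, by linarith [hx.2]⟩
      · exact ⟨by linarith [hx.1], hx.2⟩
    rw [hx']
    exact hx.imp (·.2) (·.1)
  · intro h
    exact ⟨rep (proj a), h.imp (fun h => ⟨h0, h⟩) fun h => ⟨h, h1⟩, coe_rep _⟩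

theorem measurableSet_windowSet (hq : 1 / 2 < q) : MeasurableSet (windowSet q) := by
  have hr : Measurable fun a => rep (proj a) := measurable_rep.comp continuous_proj.measurable
  have : windowSet q = {a | rep (proj a) ≤ 1 / 2} ∪ {a | q < rep (proj a)} := by
    ext a
    exact mem_windowSet hq
  rw [this]
  exact (measurableSet_le hr measurable_const).union (measurableSet_lt measurable_const hr)

/-- Points outside the window enter it at the next step. -/
theorem doublingPerm_mem_windowSet (hq : 1 / 2 < q) (hq' : q ≤ 3 / 4) {a : Solenoid}
    (ha : a ∉ windowSet q) : doublingPerm a ∈ windowSet q := by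
  rw [mem_windowSet hq, not_or, not_le, not_lt] at ha
  -- A representative in `(1/2, q]` doubles to one in `(0, 2q - 1]`, and `2q - 1 ≤ 1/2` exactly
  -- because `q ≤ 3/4`.
  rw [mem_windowSet hq, proj_doublingPerm, rep_add_self, if_neg (by linarith [ha.1])]
  exact Or.inl (by linarith [ha.2])

/-- The centered indicator of the window, as a function on the circle. -/
noncomputable def window (q : ℝ) (x : UnitAddCircle) : ℝ := step q x - step (1 / 2) x

theorem measurable_window (q : ℝ) : Measurable (window q) :=
  (measurable_step q).sub (measurable_step _)

theorem abs_window_le (q : ℝ) (x : UnitAddCircle) : |window q x| ≤ 2 := by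
  have h1 := abs_le.1 (abs_step_le q x)
  have h2 := abs_le.1 (abs_step_le (1 / 2) x)
  rw [window, abs_le]
  constructor <;> linarith

theorem integrable_step (a : ℝ) : Integrable (step a) :=
  integrable_of_bounded (measurable_step a) (abs_step_le a)

theorem integral_window (q : ℝ) : ∫ x, window q x = 0 := by
  unfold window
  rw [integral_sub (integrable_step q) (integrable_step _), integral_step, integral_step, sub_zero]

theorem integral_comp_proj {g : UnitAddCircle → ℝ} (hg : Measurable g) :
    ∫ a, g (proj a) ∂haar = ∫ x, g x :=
  measurePreserving_proj.integral_comp_of_aestronglyMeasurable hg.aestronglyMeasurable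

/-- The indicator is `1` minus that of `(1/2, 1)` plus that of `(q, 1)`; the centering constants add
up to `3/2 - q`. -/
theorem indicator_windowSet (hq : 1 / 2 < q) (hq1 : q < 1) (a : Solenoid) :
    (windowSet q).indicator (fun _ => (1 : ℝ)) a = 3 / 2 - q + window q (proj a) := by
  have hf : Int.fract q = q := Int.fract_eq_self.2 ⟨by linarith, hq1⟩
  have hf' : Int.fract (1 / 2 : ℝ) = 1 / 2 := Int.fract_eq_self.2 ⟨by norm_num, by norm_num⟩
  classical
  rw [Set.indicator_apply, mem_windowSet hq, window, step, step, hf, hf']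
  by_cases h1 : q < rep (proj a)
  · have h2 : 1 / 2 < rep (proj a) := by linarith
    rw [if_pos (Or.inr h1), if_pos h1, if_pos h2]
    ring
  · by_cases h2 : 1 / 2 < rep (proj a)
    · rw [if_neg (by rintro (h | h) <;> linarith), if_neg h1, if_pos h2]
      ring
    · rw [if_pos (Or.inl (not_lt.1 h2)), if_neg h1, if_neg h2]
      ring

theorem haar_windowSet (hq : 1 / 2 < q) (hq1 : q < 1) :
    haar.real (windowSet q) = 3 / 2 - q := by
  have hi : Integrable (fun a => window q (proj a)) haar :=
    integrable_of_bounded ((measurable_window q).comp continuous_proj.measurable)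
      fun a => abs_window_le q _
  rw [← mul_one (haar.real (windowSet q)), ← smul_eq_mul,
    ← integral_indicator_const (1 : ℝ) (measurableSet_windowSet hq)]
  simp only [indicator_windowSet hq hq1]
  rw [integral_add (integrable_const _) hi, integral_comp_proj (measurable_window q),
    integral_window]
  simp

theorem isSuspensionParameter (hq : 1 / 2 < q) (hq' : q ≤ 3 / 4) :
    IsSuspensionParameter haar doublingPerm (windowSet q) where
  standardBorel := inferInstance
  isProbabilityMeasure := inferInstance
  ergodic := ergodic_doubling
  measurable_symm := measurable_doublingPerm_symm
  measurableSet := measurableSet_windowSet hq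
  iUnion_eq := by
    refine Set.eq_univ_of_forall fun a => ?_
    by_cases ha : a ∈ windowSet q
    · exact Set.mem_iUnion.2 ⟨0, ha⟩
    · exact Set.mem_iUnion.2 ⟨1, by simpa using doublingPerm_mem_windowSet hq hq' ha⟩

/-! ### Decay of correlations -/

theorem correlation_windowSet (hq : 1 / 2 < q) (hq1 : q < 1) (n : ℕ) :
    haar.real (windowSet q ∩ (doublingPerm ^ n) ⁻¹' windowSet q) - haar.real (windowSet q) ^ 2
      = ∫ x, window q x * window q (2 ^ n • x) := by
  have hB := measurableSet_windowSet hq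
  have hTB := (measurePreserving_doublingPerm_pow n).measurable hB
  set c : ℝ := 3 / 2 - q with hc
  have hw := measurable_window q
  have hw' : Measurable fun x => window q (2 ^ n • x) := hw.comp (measurable_const_smul (2 ^ n))
  have hind : ∀ a, (windowSet q ∩ (doublingPerm ^ n) ⁻¹' windowSet q).indicator
      (fun _ => (1 : ℝ)) a
      = c ^ 2 + c * window q (proj a) + c * window q (2 ^ n • proj a)
        + window q (proj a) * window q (2 ^ n • proj a) := by
    intro a
    have h1 := indicator_windowSet hq hq1 a
    have h2 := indicator_windowSet hq hq1 ((doublingPerm ^ n) a)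
    rw [proj_doublingPerm_pow] at h2
    have h3 : (windowSet q ∩ (doublingPerm ^ n) ⁻¹' windowSet q).indicator (fun _ => (1 : ℝ)) a
        = (windowSet q).indicator (fun _ => (1 : ℝ)) a
          * (windowSet q).indicator (fun _ => (1 : ℝ)) ((doublingPerm ^ n) a) := by
      classical
      clear h1 h2
      by_cases h : a ∈ windowSet q <;> by_cases h' : (doublingPerm ^ n) a ∈ windowSet q <;>
        simp [h, h']
    rw [h3, h1, h2]
    ring
  have hi1 : Integrable (window q) := integrable_of_bounded hw (abs_window_le q)
  have hi2 : Integrable fun x => window q (2 ^ n • x) :=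
    integrable_of_bounded hw' fun x => abs_window_le q _
  have hi3 : Integrable fun x => window q x * window q (2 ^ n • x) :=
    integrable_of_bounded (hw.mul hw') (C := 2 * 2) fun x => by
      rw [abs_mul]
      exact mul_le_mul (abs_window_le q _) (abs_window_le q _) (abs_nonneg _) zero_le_two
  have hi4 : Integrable fun x => c ^ 2 + c * window q x :=
    (integrable_const _).add (hi1.const_mul c)
  have hi5 : Integrable fun x => c ^ 2 + c * window q x + c * window q (2 ^ n • x) :=
    hi4.add (hi2.const_mul c)
  have hz : ∫ x, window q (2 ^ n • x) = 0 := by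
    have h := integral_comp_proj hw'
    simp only [← proj_doublingPerm_pow] at h
    rw [← h, ← integral_window q, ← integral_comp_proj hw]
    exact (measurePreserving_doublingPerm_pow n).integral_comp_of_aestronglyMeasurable
      (hw.comp continuous_proj.measurable).aestronglyMeasurable
  have key : haar.real (windowSet q ∩ (doublingPerm ^ n) ⁻¹' windowSet q)
      = c ^ 2 + ∫ x, window q x * window q (2 ^ n • x) := by
    rw [← mul_one (haar.real _), ← smul_eq_mul, ← integral_indicator_const (1 : ℝ) (hB.inter hTB)]
    simp only [hind]
    rw [integral_comp_proj (g := fun x => c ^ 2 + c * window q x + c * window q (2 ^ n • x)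
      + window q x * window q (2 ^ n • x))
      (((measurable_const.add (hw.const_mul c)).add (hw'.const_mul c)).add (hw.mul hw')),
      integral_add hi5 hi3, integral_add hi4 (hi2.const_mul c),
      integral_add (integrable_const _) (hi1.const_mul c), integral_const_mul, integral_const_mul,
      integral_window, hz]
    simp
  rw [key, haar_windowSet hq hq1]
  ring

/-- Each of the two steps gains `2⁻ⁿ` from `integral_step_mul_pow`, against an integrand bounded by
`2`. -/
theorem abs_integral_window_mul_le (q : ℝ) (n : ℕ) :
    |∫ x, window q x * window q (2 ^ n • x)| ≤ 4 * (2⁻¹) ^ n := by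
  have hw := measurable_window q
  have hw' : Measurable fun x => window q (2 ^ n • x) := hw.comp (measurable_const_smul (2 ^ n))
  have hi : ∀ a, Integrable fun x => step a x * window q (2 ^ n • x) := fun a =>
    integrable_of_bounded ((measurable_step a).mul hw') (C := 1 * 2) fun x => by
      rw [abs_mul]
      exact mul_le_mul (abs_step_le a _) (abs_window_le q _) (abs_nonneg _) zero_le_one
  have hb : ∀ a, |∫ x, step a x * window q (2 ^ n • x)| ≤ 2 * (2⁻¹) ^ n := fun a => by
    rw [integral_step_mul_pow n a hw (abs_window_le q), abs_mul, abs_of_nonneg (by positivity),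
      mul_comm]
    refine mul_le_mul_of_nonneg_right ?_ (by positivity)
    have := norm_integral_le_of_norm_le_const (μ := (volume : Measure UnitAddCircle))
      (f := fun x => step (2 ^ n * a) x * window q x) (C := 2) (.of_forall fun x => by
        rw [Real.norm_eq_abs, abs_mul, ← one_mul (2 : ℝ)]
        exact mul_le_mul (abs_step_le _ _) (abs_window_le q _) (abs_nonneg _) zero_le_one)
    simpa using this
  have e : ∫ x, window q x * window q (2 ^ n • x)
      = (∫ x, step q x * window q (2 ^ n • x)) - ∫ x, step (1 / 2) x * window q (2 ^ n • x) := by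
    rw [← integral_sub (hi q) (hi _)]
    simp only [← sub_mul]
    rfl
  rw [e]
  refine (abs_sub _ _).trans ?_
  linarith [hb q, hb (1 / 2)]

theorem hasSummableCorrelations (hq : 1 / 2 < q) (hq1 : q < 1) :
    HasSummableCorrelations haar doublingPerm (windowSet q) := by
  have hs := (summable_pow_mul_geometric_of_norm_lt_one 1
    (show ‖(2⁻¹ : ℝ)‖ < 1 by norm_num)).mul_left 4
  refine hs.of_nonneg_of_le (fun n => by positivity) fun n => ?_
  rw [correlation_windowSet hq hq1, pow_one]
  have := mul_le_mul_of_nonneg_left (abs_integral_window_mul_le q n) (Nat.cast_nonneg (α := ℝ) n)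
  linarith

/-! ### Orthogonal differences along orbits -/

/-- The martingale differences along the orbits of `T`. -/
noncomputable def martingale (q : ℝ) (N : ℕ) (a : Solenoid) : ℝ := windowMartingale q N (proj a)

theorem measurable_martingale (q : ℝ) (N : ℕ) : Measurable (martingale q N) :=
  (measurable_windowMartingale q N).comp continuous_proj.measurable

theorem measurable_martingale_zpow (q : ℝ) (N : ℕ) (n : ℤ) :
    Measurable fun a => martingale q N ((doublingPerm ^ n) a) :=
  (measurable_martingale q N).comp (measurable_doublingPerm_zpow n)

theorem abs_martingale_le (q : ℝ) (N : ℕ) (a : Solenoid) : |martingale q N a| ≤ N + 2 :=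
  abs_windowMartingale_le q N _

theorem integral_martingale (q : ℝ) (N : ℕ) (n : ℤ) :
    ∫ a, martingale q N ((doublingPerm ^ n) a) ∂haar = 0 := by
  rw [(measurePreserving_doublingPerm_zpow n).integral_comp_of_aestronglyMeasurable
    (measurable_martingale q N).aestronglyMeasurable]
  unfold martingale
  rw [integral_comp_proj (measurable_windowMartingale q N)]
  have := integral_antiperiodic_mul (windowMartingale_add_half q N) (ψ := fun _ => 1)
    fun x => rfl
  simpa using this

/-- By invariance the earlier time may be taken to be `0`. The later factor then depends on `2 ^ (n
+ 1) • x`, which is `1/2`-periodic, while the earlier one is `1/2`-antiperiodic. -/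
theorem integral_martingale_mul_of_lt (q : ℝ) (N : ℕ) {i j : ℤ} (hij : i < j) :
    ∫ a, martingale q N ((doublingPerm ^ i) a) * martingale q N ((doublingPerm ^ j) a) ∂haar
      = 0 := by
  obtain ⟨n, rfl⟩ : ∃ n : ℕ, j = (n + 1 : ℕ) + i := ⟨(j - i - 1).toNat, by omega⟩
  have hmp := measurePreserving_doublingPerm_zpow i
  have hm := measurable_martingale q N
  have hm' : Measurable fun a => martingale q N a * martingale q N ((doublingPerm ^ (n + 1)) a) :=
    hm.mul (hm.comp (measurePreserving_doublingPerm_pow _).measurable)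
  have e := hmp.integral_comp_of_aestronglyMeasurable hm'.aestronglyMeasurable
  simp only [zpow_add, zpow_natCast, Equiv.Perm.mul_apply]
  rw [e]
  simp only [martingale, proj_doublingPerm_pow]
  have hM := measurable_windowMartingale q N
  rw [integral_comp_proj (g := fun x => windowMartingale q N x
    * windowMartingale q N (2 ^ (n + 1) • x)) (hM.mul (hM.comp (measurable_const_smul _)))]
  refine integral_antiperiodic_mul (windowMartingale_add_half q N) fun x => ?_
  have : (2 ^ (n + 1)) • ((1 / 2 : ℝ) : UnitAddCircle) = 0 := by
    rw [pow_succ', mul_nsmul, two_nsmul, ← AddCircle.coe_add, add_halves, AddCircle.coe_period,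
      nsmul_zero]
  rw [nsmul_add, this, add_zero]

theorem integral_martingale_sq (q : ℝ) (N : ℕ) (i : ℤ) :
    ∫ a, martingale q N ((doublingPerm ^ i) a) ^ 2 ∂haar = ∫ x, windowMartingale q N x ^ 2 := by
  rw [(measurePreserving_doublingPerm_zpow i).integral_comp_of_aestronglyMeasurable
    (g := fun a => martingale q N a ^ 2)
    ((measurable_martingale q N).pow_const 2).aestronglyMeasurable]
  unfold martingale
  rw [integral_comp_proj (g := fun x => windowMartingale q N x ^ 2)
    ((measurable_windowMartingale q N).pow_const 2)]

/-- Orthogonality of martingale differences. -/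
theorem integral_sum_martingale_sq (q : ℝ) (N : ℕ) (s : Finset ℤ) :
    ∫ a, (∑ n ∈ s, martingale q N ((doublingPerm ^ n) a)) ^ 2 ∂haar
      = s.card * ∫ x, windowMartingale q N x ^ 2 := by
  have hm := measurable_martingale_zpow q N
  have hi : ∀ i j : ℤ, Integrable (fun a => martingale q N ((doublingPerm ^ i) a)
      * martingale q N ((doublingPerm ^ j) a)) haar := fun i j =>
    integrable_of_bounded ((hm i).mul (hm j)) (C := (N + 2) * (N + 2)) fun a => by
      rw [abs_mul]
      exact mul_le_mul (abs_martingale_le _ _ _) (abs_martingale_le _ _ _) (abs_nonneg _)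
        (by positivity)
  simp only [sq, Finset.sum_mul_sum]
  rw [integral_finsetSum _ fun i _ => integrable_finsetSum _ fun j _ => hi i j]
  have : ∀ i ∈ s, ∫ a, ∑ j ∈ s, martingale q N ((doublingPerm ^ i) a)
      * martingale q N ((doublingPerm ^ j) a) ∂haar = ∫ x, windowMartingale q N x ^ 2 := by
    intro i his
    rw [integral_finsetSum _ fun j _ => hi i j, Finset.sum_eq_single_of_mem i his]
    · simp only [← sq]
      exact integral_martingale_sq q N i
    · intro j _ hji
      rcases hji.lt_or_gt with h | h
      · simpa only [mul_comm] using integral_martingale_mul_of_lt q N h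
      · exact integral_martingale_mul_of_lt q N h
  rw [Finset.sum_congr rfl this]
  simp [sq]

/-- The difference telescopes to two values of the bounded transfer function. The null set is
independent of the endpoints, which later vary with the time coordinate of the suspension. -/
theorem ae_abs_sum_window_sub_sum_martingale_le {k : ℤ} {N : ℕ} (hk : q = k / 2 ^ N) :
    ∀ᵐ a ∂haar, ∀ α β : ℤ,
      |∑ n ∈ Finset.Ico α β, window q (proj ((doublingPerm ^ n) a))
        - ∑ n ∈ Finset.Ico α β, martingale q N ((doublingPerm ^ n) a)| ≤ 2 * (N + 2) := by
  have h1 : ∀ᵐ a ∂haar, window q (proj a)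
      = martingale q N a + windowTransfer q N (proj (doublingPerm a))
        - windowTransfer q N (proj a) := by
    have h := measurePreserving_proj.quasiMeasurePreserving.tendsto_ae.eventually
      (ae_step_sub_step_eq hk)
    filter_upwards [h] with a ha
    rw [proj_doublingPerm]
    exact ha
  filter_upwards [ae_forall_zpow h1] with a ha α β
  rcases le_total β α with h | h
  · rw [Finset.Ico_eq_empty (not_lt.2 h)]
    simp only [Finset.sum_empty, sub_self, abs_zero]
    positivity
  · obtain ⟨m, rfl⟩ : ∃ m : ℕ, β = α + m := ⟨(β - α).toNat, by omega⟩
    have htel : ∀ m : ℕ, ∑ n ∈ Finset.Ico α (α + m), window q (proj ((doublingPerm ^ n) a))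
        - ∑ n ∈ Finset.Ico α (α + m), martingale q N ((doublingPerm ^ n) a)
        = windowTransfer q N (proj ((doublingPerm ^ (α + m)) a))
          - windowTransfer q N (proj ((doublingPerm ^ α) a)) := by
      intro m
      rw [Finset.sum_Ico_add_natCast, Finset.sum_Ico_add_natCast, ← Finset.sum_sub_distrib]
      have : ∀ i ∈ Finset.range m, window q (proj ((doublingPerm ^ (α + i)) a))
          - martingale q N ((doublingPerm ^ (α + i)) a)
          = windowTransfer q N (proj ((doublingPerm ^ (α + (i + 1 : ℕ))) a))
            - windowTransfer q N (proj ((doublingPerm ^ (α + i)) a)) := by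
        intro i _
        have e : (doublingPerm ^ (α + (i + 1 : ℕ))) a = doublingPerm ((doublingPerm ^ (α + i)) a) := by
          rw [← Equiv.Perm.mul_apply, ← zpow_one_add]
          congr 2
          push_cast
          ring
        rw [ha, e]
        ring
      rw [Finset.sum_congr rfl this,
        Finset.sum_range_sub fun i : ℕ => windowTransfer q N (proj ((doublingPerm ^ (α + i)) a))]
      simp
    rw [htel]
    refine (abs_sub _ _).trans ?_
    linarith [abs_windowTransfer_le q N (proj ((doublingPerm ^ (α + m)) a)),
      abs_windowTransfer_le q N (proj ((doublingPerm ^ α) a))]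

/-- Birkhoff sums of a coboundary are bounded in `L²`, hence so are the martingale sums, whose
second moment `m * v` is unbounded. Real parts suffice because the window function is real. -/
theorem not_isL2Coboundary (hq : 1 / 2 < q) (hq1 : q < 1) {k : ℤ} {N : ℕ} (hk : q = k / 2 ^ N) :
    ¬ IsL2Coboundary haar doublingPerm (centeredIndicator haar (windowSet q)) := by
  rintro ⟨F, hF, hFe⟩
  set G : Solenoid → ℝ := fun a => (F a).re with hG
  have hG2 : MemLp G 2 haar := hF.re
  have hGe : ∀ᵐ a ∂haar, window q (proj a) = G a - G (doublingPerm a) := by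
    filter_upwards [hFe] with a ha
    have h := congrArg Complex.re ha
    have hi := indicator_windowSet hq hq1 a
    have hc : (centeredIndicator haar (windowSet q) a).re = window q (proj a) := by
      rw [centeredIndicator, haar_windowSet hq hq1]
      have : ((windowSet q).indicator (fun _ => (1 : ℂ)) a).re
          = (windowSet q).indicator (fun _ => (1 : ℝ)) a := by
        classical
        simp only [Set.indicator_apply]
        split_ifs <;> simp
      rw [Complex.sub_re, this, hi, Complex.ofReal_re]
      ring
    rw [hc, Complex.sub_re] at h
    exact h
  set v := ∫ x, windowMartingale q N x ^ 2 with hv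
  have hvpos : 0 < v := integral_windowMartingale_sq_pos hq hq1 N
  set I := ∫ a, G a ^ 2 ∂haar with hI
  have hbound : ∀ m : ℕ, m * v ≤ 3 * (I + I + (2 * (N + 2)) ^ 2) := by
    intro m
    have hmp := measurePreserving_doublingPerm_zpow m
    have hGm : MemLp (fun a => G ((doublingPerm ^ (m : ℤ)) a)) 2 haar :=
      hG2.comp_measurePreserving hmp
    have hIm : ∫ a, G ((doublingPerm ^ (m : ℤ)) a) ^ 2 ∂haar = I :=
      hmp.integral_comp_of_aestronglyMeasurable (hG2.aestronglyMeasurable.pow 2)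
    have hle : ∀ᵐ a ∂haar,
        (∑ n ∈ Finset.Ico (0 : ℤ) m, martingale q N ((doublingPerm ^ n) a)) ^ 2
          ≤ 3 * (G a ^ 2 + G ((doublingPerm ^ (m : ℤ)) a) ^ 2 + (2 * (N + 2)) ^ 2) := by
      filter_upwards [ae_forall_zpow hGe, ae_abs_sum_window_sub_sum_martingale_le hk] with a h1 h2
      have h3 := h2 0 m
      have h4 : ∑ n ∈ Finset.Ico (0 : ℤ) m, window q (proj ((doublingPerm ^ n) a))
          = G a - G ((doublingPerm ^ (m : ℤ)) a) := by
        have e := Finset.sum_Ico_add_natCast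
          (fun n : ℤ => window q (proj ((doublingPerm ^ n) a))) 0 m
        rw [zero_add] at e
        rw [e]
        have : ∀ i ∈ Finset.range m, window q (proj ((doublingPerm ^ ((0 : ℤ) + i)) a))
            = G ((doublingPerm ^ (i : ℤ)) a) - G ((doublingPerm ^ ((i + 1 : ℕ) : ℤ)) a) := by
          intro i _
          rw [zero_add, h1, ← Equiv.Perm.mul_apply, ← zpow_one_add]
          congr 4
          push_cast
          ring
        rw [Finset.sum_congr rfl this,
          Finset.sum_range_sub' fun i : ℕ => G ((doublingPerm ^ (i : ℤ)) a)]
        simp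
      rw [h4] at h3
      set x := G a
      set y := G ((doublingPerm ^ (m : ℤ)) a)
      set z := ∑ n ∈ Finset.Ico (0 : ℤ) m, martingale q N ((doublingPerm ^ n) a)
      have h5 : (x - y - z) ^ 2 ≤ (2 * (N + 2)) ^ 2 := sq_le_sq' (abs_le.1 h3).1 (abs_le.1 h3).2
      -- With `w = x - y - z`, this is `(x - y - w)² ≤ 3 (x² + y² + w²)`; the defect is the sum of
      -- the three squares supplied.
      nlinarith [sq_nonneg (x + y), sq_nonneg (x + (x - y - z)), sq_nonneg (y - (x - y - z))]
    have hi1 := hG2.integrable_sq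
    have hi2 := hGm.integrable_sq
    have hi3 : Integrable (fun a => G a ^ 2 + G ((doublingPerm ^ (m : ℤ)) a) ^ 2) haar :=
      hi1.add hi2
    have hr : Integrable (fun a => 3 * (G a ^ 2 + G ((doublingPerm ^ (m : ℤ)) a) ^ 2
        + (2 * ((N : ℝ) + 2)) ^ 2)) haar := (hi3.add (integrable_const _)).const_mul 3
    have := integral_mono_of_nonneg (.of_forall fun a => sq_nonneg _) hr hle
    rw [integral_sum_martingale_sq, integral_const_mul,
      integral_add hi3 (integrable_const _), integral_add hi1 hi2, hIm] at this
    simpa using this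
  obtain ⟨m, hm⟩ := exists_nat_gt (3 * (I + I + (2 * (N + 2)) ^ 2) / v)
  rw [div_lt_iff₀ hvpos] at hm
  exact absurd (hbound m) (not_le.2 hm)

end Solenoid

/-! ### Suspension processes -/

theorem MeasurableEquiv.standardBorelSpace_of_equiv {α β : Type*} [MeasurableSpace α]
    [MeasurableSpace β] [StandardBorelSpace β] (e : α ≃ᵐ β) : StandardBorelSpace α := by
  obtain ⟨τ, hb, hp⟩ := StandardBorelSpace.polish (α := β)
  let t : TopologicalSpace α := TopologicalSpace.induced e τ
  refine ⟨t, ⟨?_⟩, e.toEquiv.polishSpace_induced⟩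
  rw [← e.measurableEmbedding.comap_eq]
  exact (congrArg (MeasurableSpace.comap e) hb.measurable_eq).trans borel_comap.symm

theorem diracComb_image_apply {g : ℤ → ℝ} (hg : Function.Injective g) (A : Set ℤ) {s : Set ℝ}
    (hs : MeasurableSet s) :
    diracComb (g '' A) s = ∑' n : ℤ, A.indicator (fun n => s.indicator 1 (g n)) n := by
  rw [diracComb, Measure.sum_apply _ hs, ← tsum_subtype]
  simp only [Measure.dirac_apply' _ hs]
  exact tsum_image (fun x => s.indicator (1 : ℝ → ℝ≥0∞) x) hg.injOn

theorem isTwoSyndetic_of_forall {A : Set ℤ} (h : ∀ n, n ∉ A → n + 1 ∈ A) : IsTwoSyndetic A := by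
  refine ⟨0, -1, Set.eq_univ_of_forall fun n => ?_⟩
  by_cases hn : n ∈ A
  · exact Or.inl (by simpa using hn)
  · refine Or.inr (Set.mem_vadd_set.2 ⟨n + 1, h n hn, ?_⟩)
    rw [vadd_eq_add]
    ring

theorem isLocallyFiniteSet_image_sub (A : Set ℤ) (t : ℝ) :
    IsLocallyFiniteSet ((fun n : ℤ => (n : ℝ) - t) '' A) := by
  intro C hC
  obtain ⟨r, hr⟩ := hC.isBounded.subset_closedBall 0
  refine ((Set.finite_Icc ⌊t - r⌋ ⌈t + r⌉).image fun n : ℤ => (n : ℝ) - t).subset ?_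
  rintro _ ⟨⟨n, -, rfl⟩, hn⟩
  have h := abs_le.1 (by simpa using hr hn : |(n : ℝ) - t| ≤ r)
  refine ⟨n, ⟨Int.floor_le_iff.2 ?_, Int.le_ceil_iff.2 ?_⟩, rfl⟩ <;> linarith [h.1, h.2]

/-- Differences of points are integers, hence `1`-separated. For density, of the two integers around
`x + t` at least one lies in `A`, so `[-1, 1]` serves as compact set. -/
theorem isMeyerSet_image_sub {A : Set ℤ} (h : ∀ n, n ∉ A → n + 1 ∈ A) (t : ℝ) :
    IsMeyerSet ((fun n : ℤ => (n : ℝ) - t) '' A) where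
  relativelyDense := by
    refine ⟨Set.Icc (-1) 1, isCompact_Icc, Set.eq_univ_of_forall fun x => ?_⟩
    have h1 := Int.floor_le (x + t)
    have h2 := Int.lt_floor_add_one (x + t)
    by_cases hn : ⌊x + t⌋ ∈ A
    · exact Set.mem_add.2 ⟨_, ⟨_, hn, rfl⟩, x - (⌊x + t⌋ - t), ⟨by linarith, by linarith⟩,
        by simp⟩
    · refine Set.mem_add.2 ⟨_, ⟨_, h _ hn, rfl⟩, x - ((⌊x + t⌋ + 1 : ℤ) - t), ?_, by simp⟩
      push_cast
      exact ⟨by linarith, by linarith⟩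
  uniformlyDiscrete_sub := by
    refine ⟨1, one_pos, ?_⟩
    rintro _ ⟨_, ⟨a, -, rfl⟩, _, ⟨b, -, rfl⟩, rfl⟩ _ ⟨_, ⟨c, -, rfl⟩, _, ⟨d, -, rfl⟩, rfl⟩ hne
    have e : (a : ℝ) - t - (b - t) - (c - t - (d - t)) = ((a - b - (c - d) : ℤ) : ℝ) := by
      push_cast
      ring
    simp only [Real.dist_eq, e]
    have : a - b - (c - d) ≠ 0 := by
      intro h0
      apply hne
      rw [← sub_eq_zero]
      simp only [e, h0, Int.cast_zero]
    exact_mod_cast Int.one_le_abs this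

namespace Suspension

variable {Z : Type*} (T : Equiv.Perm Z)

theorem mk_surjective : Function.Surjective (mk T) := Quotient.mk_surjective

theorem mk_sub_zpow (t : ℝ) (z : Z) (n : ℤ) : mk T (t - n, (T ^ n) z) = mk T (t, z) :=
  (Quotient.sound (s := suspensionSetoid T) (a := (t, z)) ⟨n, rfl⟩).symm

theorem mk_add_one (t : ℝ) (z : Z) : mk T (t + 1, z) = mk T (t, T z) := by
  have h := mk_sub_zpow T (t + 1) z 1
  rw [Int.cast_one, add_sub_cancel_right, zpow_one] at h
  exact h.symm

theorem vadd_mk (x t : ℝ) (z : Z) : x +ᵥ mk T (t, z) = mk T (x + t, z) := rfl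

/-- The time coordinate in `[0, 1)`. -/
noncomputable def time : Suspension T → ℝ :=
  Quotient.lift (fun a : ℝ × Z => Int.fract a.1) (by
    rintro a b ⟨n, rfl⟩
    simp)

/-- The coordinate in the base, at time in `[0, 1)`. -/
noncomputable def base : Suspension T → Z :=
  Quotient.lift (fun a : ℝ × Z => (T ^ ⌊a.1⌋) a.2) (by
    rintro a b ⟨n, rfl⟩
    simp only [Int.floor_sub_intCast]
    rw [← Equiv.Perm.mul_apply, ← zpow_add, sub_add_cancel])

theorem time_mk (t : ℝ) (z : Z) : time T (mk T (t, z)) = Int.fract t := rfl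

theorem base_mk (t : ℝ) (z : Z) : base T (mk T (t, z)) = (T ^ ⌊t⌋) z := rfl

theorem mk_time_base (ω : Suspension T) : mk T (time T ω, base T ω) = ω := by
  obtain ⟨⟨t, z⟩, rfl⟩ := mk_surjective T ω
  rw [time_mk, base_mk, ← Int.self_sub_floor, mk_sub_zpow]

theorem time_mem (ω : Suspension T) : time T ω ∈ Set.Ico (0 : ℝ) 1 := by
  obtain ⟨⟨t, z⟩, rfl⟩ := mk_surjective T ω
  exact ⟨Int.fract_nonneg _, Int.fract_lt_one _⟩

theorem points_mk (B : Set Z) (t : ℝ) (z : Z) :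
    points T B (mk T (t, z)) = (fun n : ℤ => (n : ℝ) - t) '' {n : ℤ | (T ^ n) z ∈ B} := by
  ext x
  constructor
  · rintro ⟨n, hn, rfl⟩
    exact ⟨n, hn, rfl⟩
  · rintro ⟨n, hn, rfl⟩
    exact ⟨n, hn, rfl⟩

theorem process_mk_apply (B : Set Z) (t : ℝ) (z : Z) {s : Set ℝ} (hs : MeasurableSet s) :
    process T B (mk T (t, z)) s
      = ∑' n : ℤ, B.indicator (fun _ => s.indicator 1 ((n : ℝ) - t)) ((T ^ n) z) := by
  rw [process, points_mk, diracComb_image_apply (fun m n h => by simpa using h) _ hs]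
  rfl

/-! ### Counting points in balls -/

/-- The integers in the open interval of radius `R` centered at `t`. -/
noncomputable def window (t R : ℝ) : Finset ℤ := Finset.Ico (⌊t - R⌋ + 1) ⌈t + R⌉

theorem mem_window {t R : ℝ} {n : ℤ} : n ∈ window t R ↔ |(n : ℝ) - t| < R := by
  rw [window, Finset.mem_Ico, Int.add_one_le_iff, Int.floor_lt, Int.lt_ceil, abs_lt]
  constructor <;> rintro ⟨h1, h2⟩ <;> constructor <;> linarith

theorem abs_card_window_sub_le (t : ℝ) {R : ℝ} (hR : 1 ≤ R) :
    |((window t R).card : ℝ) - 2 * R| ≤ 1 := by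
  have h1 := Int.floor_le (t - R)
  have h2 := Int.lt_floor_add_one (t - R)
  have h3 := Int.le_ceil (t + R)
  have h4 := Int.ceil_lt_add_one (t + R)
  -- Guarantees that `toNat` in the cardinality of the interval does not truncate.
  have h5 : ⌊t - R⌋ + 1 ≤ ⌈t + R⌉ := by
    rw [Int.add_one_le_iff]
    exact_mod_cast (by linarith : (⌊t - R⌋ : ℝ) < ⌈t + R⌉)
  have h6 : ((window t R).card : ℝ) = ⌈t + R⌉ - (⌊t - R⌋ + 1) := by
    rw [window, Int.card_Ico, ← Int.cast_natCast, Int.toNat_of_nonneg (by omega)]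
    push_cast
    ring
  rw [h6, abs_le]
  constructor <;> linarith

theorem process_mk_ball (B : Set Z) (t : ℝ) (z : Z) (R : ℝ) :
    process T B (mk T (t, z)) (Metric.ball 0 R)
      = ∑ n ∈ window t R, B.indicator 1 ((T ^ n) z) := by
  have hmem : ∀ n : ℤ, (n : ℝ) - t ∈ Metric.ball (0 : ℝ) R ↔ n ∈ window t R := fun n => by
    rw [mem_window, mem_ball_zero_iff, Real.norm_eq_abs]
  rw [process_mk_apply T B t z Metric.isOpen_ball.measurableSet,
    tsum_eq_sum (s := window t R) fun n hn => ?_]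
  · refine Finset.sum_congr rfl fun n hn => ?_
    rw [Set.indicator_of_mem ((hmem n).2 hn)]
    rfl
  · rw [Set.indicator_of_notMem fun h => hn ((hmem n).1 h)]
    simp

theorem process_mk_ball_le (B : Set Z) (t : ℝ) (z : Z) (R : ℝ) :
    process T B (mk T (t, z)) (Metric.ball 0 R) ≤ (window t R).card := by
  rw [process_mk_ball]
  have : ∀ n ∈ window t R, B.indicator (1 : Z → ℝ≥0∞) ((T ^ n) z) ≤ 1 := fun n _ =>
    Set.indicator_apply_le' (fun _ => le_rfl) fun _ => zero_le_one
  simpa using Finset.sum_le_sum this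

theorem process_ball_le (B : Set Z) (ω : Suspension T) {R : ℝ} (hR : 1 ≤ R) :
    process T B ω (Metric.ball 0 R) ≤ ENNReal.ofReal (2 * R + 1) := by
  obtain ⟨⟨t, z⟩, rfl⟩ := mk_surjective T ω
  refine (process_mk_ball_le T B t z R).trans ?_
  rw [← ENNReal.ofReal_natCast]
  exact ENNReal.ofReal_le_ofReal (by linarith [(abs_le.1 (abs_card_window_sub_le t hR)).2])

theorem process_vadd (B : Set Z) (x : ℝ) (ω : Suspension T) :
    process T B (x +ᵥ ω) = (process T B ω).map fun y => y - x := by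
  obtain ⟨⟨t, z⟩, rfl⟩ := mk_surjective T ω
  ext s hs
  have hm : Measurable fun y : ℝ => y - x := measurable_id.sub_const x
  rw [Measure.map_apply hm hs, vadd_mk, process_mk_apply T B _ z hs,
    process_mk_apply T B t z (hm hs)]
  refine tsum_congr fun n => ?_
  have : (n : ℝ) - (x + t) = (n : ℝ) - t - x := by ring
  rw [this]
  rfl

theorem isLocallyFiniteMeasure_process (B : Set Z) (ω : Suspension T) :
    IsLocallyFiniteMeasure (process T B ω) := by
  refine ⟨fun x => ⟨Metric.ball 0 (|x| + 1), Metric.isOpen_ball.mem_nhds (by simp), ?_⟩⟩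
  exact (process_ball_le T B ω (by linarith [abs_nonneg x])).trans_lt ENNReal.ofReal_lt_top

/-! ### Measurable structure of the suspension -/

variable [MeasurableSpace Z]

theorem measurable_mk : Measurable (mk T) := fun _ hs => hs

theorem measurable_of_comp_mk {β : Type*} [MeasurableSpace β] {f : Suspension T → β}
    (hf : Measurable (f ∘ mk T)) : Measurable f := fun _ hs => hf hs

theorem measurable_time : Measurable (time T) :=
  measurable_of_comp_mk T (measurable_fract.comp measurable_fst)

variable {T}

theorem measurable_zpow (hT : Measurable T) (hT' : Measurable T.symm) (n : ℤ) :
    Measurable (T ^ n) := by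
  obtain ⟨m, rfl | rfl⟩ := n.eq_nat_or_neg
  · rw [zpow_natCast, ← Equiv.Perm.iterate_eq_pow]
    exact hT.iterate m
  · rw [zpow_neg, zpow_natCast, ← inv_pow, ← Equiv.Perm.iterate_eq_pow]
    exact hT'.iterate m

theorem measurable_base (hT : Measurable T) (hT' : Measurable T.symm) : Measurable (base T) := by
  refine measurable_of_comp_mk T ?_
  have h : Measurable fun v : ℤ × Z => (T ^ v.1) v.2 :=
    measurable_from_prod_countable_right fun n => measurable_zpow hT hT' n
  exact h.comp ((Int.measurable_floor.comp measurable_fst).prodMk measurable_snd)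

/-- The suspension as a measurable space is a product. -/
noncomputable def equivProd (hT : Measurable T) (hT' : Measurable T.symm) :
    Suspension T ≃ᵐ Set.Ico (0 : ℝ) 1 × Z where
  toFun ω := (⟨time T ω, time_mem T ω⟩, base T ω)
  invFun v := mk T (v.1, v.2)
  left_inv ω := mk_time_base T ω
  right_inv := by
    rintro ⟨⟨t, ht⟩, z⟩
    have h0 : ⌊t⌋ = 0 := Int.floor_eq_zero_iff.2 ht
    have h1 : Int.fract t = t := Int.fract_eq_self.2 ht
    simp [time_mk, base_mk, h0, h1]
  measurable_toFun := ((measurable_time T).subtype_mk).prodMk (measurable_base hT hT')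
  measurable_invFun :=
    (measurable_mk T).comp ((measurable_subtype_coe.comp measurable_fst).prodMk measurable_snd)

theorem standardBorelSpace [StandardBorelSpace Z] (hT : Measurable T) (hT' : Measurable T.symm) :
    StandardBorelSpace (Suspension T) := by
  have : StandardBorelSpace (Set.Ico (0 : ℝ) 1) := measurableSet_Ico.standardBorel
  exact (equivProd hT hT').standardBorelSpace_of_equiv

/-- The quotient `σ`-algebra tests maps out of the suspension, not out of its product with `ℝ`. The
measurable section `(time, base)` lifts the action to the cover. -/
theorem measurableVAdd₂ (hT : Measurable T) (hT' : Measurable T.symm) :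
    MeasurableVAdd₂ ℝ (Suspension T) := by
  refine ⟨?_⟩
  have e : (fun v : ℝ × Suspension T => v.1 +ᵥ v.2)
      = fun v => mk T (v.1 + time T v.2, base T v.2) := by
    ext ⟨x, ω⟩
    conv_lhs => rw [← mk_time_base T ω]
    rfl
  have h : Measurable fun v : ℝ × Suspension T => v.1 +ᵥ v.2 := by
    rw [e]
    exact (measurable_mk T).comp ((measurable_fst.add ((measurable_time T).comp measurable_snd)).prodMk
      ((measurable_base hT hT').comp measurable_snd))
  exact h

theorem measurable_process (hT : Measurable T) (hT' : Measurable T.symm) {B : Set Z}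
    (hB : MeasurableSet B) : Measurable (process T B) := by
  refine Measure.measurable_of_measurable_coe _ fun s hs => measurable_of_comp_mk T ?_
  have e : (fun ω => process T B ω s) ∘ mk T = fun v : ℝ × Z =>
      ∑' n : ℤ, ((T ^ n) ⁻¹' B).indicator 1 v.2 * s.indicator 1 ((n : ℝ) - v.1) := by
    ext ⟨t, z⟩
    rw [Function.comp_apply, process_mk_apply T B t z hs]
    refine tsum_congr fun n => ?_
    by_cases h : (T ^ n) z ∈ B
    · rw [Set.indicator_of_mem h, Set.indicator_of_mem (Set.mem_preimage.2 h), Pi.one_apply,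
        one_mul]
    · rw [Set.indicator_of_notMem h, Set.indicator_of_notMem (mt Set.mem_preimage.1 h), zero_mul]
  rw [e]
  refine Measurable.tsum fun n => ?_
  exact ((measurable_one.indicator (measurable_zpow hT hT' n hB)).comp measurable_snd).mul
    ((measurable_one.indicator hs).comp (measurable_const.sub measurable_fst))

/-! ### Invariance and ergodicity of the suspension measure -/

variable {θ : Measure Z}

instance isProbabilityMeasure_restrict_Ico :
    IsProbabilityMeasure (volume.restrict (Set.Ico (0 : ℝ) 1)) := ⟨by simp⟩

theorem isProbabilityMeasure [IsProbabilityMeasure θ] : IsProbabilityMeasure (measure T θ) :=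
  Measure.isProbabilityMeasure_map (measurable_mk T).aemeasurable

theorem measure_apply [SFinite θ] {s : Set (Suspension T)} (hs : MeasurableSet s) :
    measure T θ s = ∫⁻ t in Set.Ico (0 : ℝ) 1, θ {z | mk T (t, z) ∈ s} := by
  rw [measure, Measure.map_apply (measurable_mk T) hs, Measure.prod_apply (measurable_mk T hs)]
  rfl

/-- As `T` preserves `θ`, the measure of the slice at time `t` is `1`-periodic in `t`. It descends
to the circle, where Lebesgue measure is translation invariant. -/
theorem vaddInvariantMeasure [SFinite θ] (hT : MeasurePreserving T θ θ) :
    VAddInvariantMeasure ℝ (Suspension T) (measure T θ) := by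
  refine ⟨fun x s hs => ?_⟩
  have hx : Measurable fun ω : Suspension T => x +ᵥ ω := by
    refine measurable_of_comp_mk T ?_
    exact (measurable_mk T).comp ((measurable_fst.const_add x).prodMk measurable_snd)
  set α : ℝ → ℝ≥0∞ := fun t => θ {z | mk T (t, z) ∈ s} with hα
  have hper : Function.Periodic α 1 := fun t => by
    simp only [hα, mk_add_one]
    have hm : MeasurableSet {z | mk T (t, z) ∈ s} :=
      measurable_prodMk_left (measurable_mk T hs)
    exact hT.measure_preimage hm.nullMeasurableSet
  have hint : ∀ y : ℝ, ∫⁻ t in Set.Ico (0 : ℝ) 1, α (y + t) = ∫⁻ b, hper.lift b := by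
    intro y
    have h := UnitAddCircle.lintegral_preimage 0 fun b => hper.lift ((y : UnitAddCircle) + b)
    rw [lintegral_add_left_eq_self (μ := (volume : Measure UnitAddCircle)) hper.lift, zero_add] at h
    rw [← h, Measure.restrict_congr_set Ico_ae_eq_Ioc]
    rfl
  rw [measure_apply (hx hs), measure_apply hs]
  have h0 := hint 0
  simp only [zero_add] at h0
  exact (hint x).trans h0.symm

/-- Ergodicity passes to the suspension. -/
theorem ergodicVAdd [IsProbabilityMeasure θ] (hT : Ergodic T θ) :
    ErgodicVAdd ℝ (Suspension T) (measure T θ) where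
  toVAddInvariantMeasure := vaddInvariantMeasure hT.toMeasurePreserving
  aeconst_of_forall_preimage_vadd_ae_eq := by
    intro s hs hinv
    set ν : Measure (ℝ × Z) := (volume.restrict (Set.Ico (0 : ℝ) 1)).prod θ with hν
    have h1 : ∀ x : ℝ, ∀ᵐ v ∂ν, mk T (x + v.1, v.2) ∈ s ↔ mk T v ∈ s := fun x => by
      filter_upwards [ae_of_ae_map (measurable_mk T).aemeasurable (hinv x)] with v hv
      exact iff_of_eq hv
    have hms : MeasurableSet {v : ℝ × Z | mk T v ∈ s} := measurable_mk T hs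
    have hW : MeasurableSet {w : ℝ × (ℝ × Z) | mk T (w.1 + w.2.1, w.2.2) ∈ s ↔ mk T w.2 ∈ s} := by
      have ha : Measurable fun w : ℝ × (ℝ × Z) => (w.1 + w.2.1, w.2.2) := by fun_prop
      exact (ha hms).iff (measurable_snd hms)
    -- Fubini exchanges quantifiers: along almost every flow line, membership in `s` is constant for
    -- almost every time. The slice `A` at one good time `t₀` then decides membership.
    have h2 : ∀ᵐ v ∂ν, ∀ᵐ x : ℝ, mk T (x + v.1, v.2) ∈ s ↔ mk T v ∈ s :=
      (Measure.ae_ae_comm (μ := volume) (ν := ν)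
        (p := fun x v => mk T (x + v.1, v.2) ∈ s ↔ mk T v ∈ s) hW).1 (.of_forall h1)
    obtain ⟨t₀, ht₀⟩ := (Measure.ae_ae_of_ae_prod h2).exists
    set A : Set Z := {z | mk T (t₀, z) ∈ s}
    have hA : MeasurableSet A := measurable_prodMk_left hms
    have h3 : ∀ᵐ z ∂θ, ∀ᵐ r : ℝ, mk T (r, z) ∈ s ↔ z ∈ A := by
      filter_upwards [ht₀] with z hz
      have := (measurePreserving_sub_right (volume : Measure ℝ)
        t₀).quasiMeasurePreserving.tendsto_ae.eventually hz
      filter_upwards [this] with r hr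
      rw [sub_add_cancel] at hr
      exact hr
    -- The points `z` and `T z` lie on one flow line, with times shifted by `1`. Two conull sets of
    -- times intersect, so `A` gives both the same verdict.
    have h4 : T ⁻¹' A =ᵐ[θ] A := by
      have h3' := hT.quasiMeasurePreserving.tendsto_ae.eventually h3
      filter_upwards [h3, h3'] with z hz hz'
      have hz1 := (quasiMeasurePreserving_add_right (volume : Measure ℝ) 1).tendsto_ae.eventually hz
      obtain ⟨r, hr, hr'⟩ := (hz1.and hz').exists
      rw [mk_add_one] at hr
      exact propext (hr'.symm.trans hr)
    have h5 := hT.quasiErgodic.aeconst_set₀ hA.nullMeasurableSet h4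
    have hm6 : MeasurableSet {w : Z × ℝ | mk T (w.2, w.1) ∈ s ↔ w.1 ∈ A} :=
      (measurable_swap hms).iff (measurable_fst hA)
    have h6 : ∀ᵐ r : ℝ, ∀ᵐ z ∂θ, mk T (r, z) ∈ s ↔ z ∈ A :=
      (Measure.ae_ae_comm (μ := θ) (ν := (volume : Measure ℝ))
        (p := fun z r => mk T (r, z) ∈ s ↔ z ∈ A) hm6).1 h3
    rw [eventuallyConst_set] at h5 ⊢
    rw [measure]
    have hm : ∀ᵐ r ∂volume.restrict (Set.Ico (0 : ℝ) 1), ∀ᵐ z ∂θ, mk T (r, z) ∈ s ↔ z ∈ A :=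
      ae_restrict_of_ae h6
    refine h5.imp (fun h => ?_) fun h => ?_
    · refine (ae_map_iff (measurable_mk T).aemeasurable hs).2 ?_
      refine (Measure.ae_prod_iff_ae_ae hms).2 ?_
      filter_upwards [hm] with r hr
      filter_upwards [hr, h] with z hz hz'
      exact hz.2 hz'
    · refine (ae_map_iff (measurable_mk T).aemeasurable hs.compl).2 ?_
      refine (Measure.ae_prod_iff_ae_ae hms.compl).2 ?_
      filter_upwards [hm] with r hr
      filter_upwards [hr, h] with z hz hz'
      exact fun h => hz' (hz.1 h)

theorem isMeyerianPointProcess {B : Set Z} (h : IsSuspensionParameter θ T B)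
    (hB : ∀ z, z ∉ B → T z ∈ B) : IsMeyerianPointProcess (measure T θ) (process T B) := by
  have := h.isProbabilityMeasure
  have := h.standardBorel
  have hT := h.ergodic.measurable
  have hT' := h.measurable_symm
  have := isProbabilityMeasure (T := T) (θ := θ)
  have hstep : ∀ z (n : ℤ), n ∉ {n : ℤ | (T ^ n) z ∈ B} → n + 1 ∈ {n : ℤ | (T ^ n) z ∈ B} := by
    intro z n hn
    have := hB _ hn
    rwa [← Equiv.Perm.mul_apply, ← zpow_one_add, add_comm] at this
  exact
    { standardBorel := standardBorelSpace hT hT'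
      isProbabilityMeasure := inferInstance
      measurable_action := measurableVAdd₂ hT hT'
      invariant := vaddInvariantMeasure h.ergodic.toMeasurePreserving
      measurable := measurable_process hT hT' h.measurableSet
      isLocallyFinite := isLocallyFiniteMeasure_process T B
      equivariant := process_vadd T B
      locallySquareIntegrable := fun A hA hbdd => by
        obtain ⟨r, hr⟩ := hbdd.subset_ball 0
        have hle : ∀ ω, (process T B ω A) ^ 2 ≤ ENNReal.ofReal (2 * (|r| + 1) + 1) ^ 2 := fun ω => by
          gcongr
          refine (measure_mono (hr.trans (Metric.ball_subset_ball ?_))).trans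
            (process_ball_le T B ω (R := |r| + 1) (by linarith [abs_nonneg r]))
          linarith [le_abs_self r]
        refine (lintegral_mono hle).trans_lt ?_
        rw [lintegral_const, measure_univ, mul_one]
        exact ENNReal.pow_lt_top ENNReal.ofReal_lt_top
      simple := .of_forall fun ω => by
        obtain ⟨⟨t, z⟩, rfl⟩ := mk_surjective T ω
        refine ⟨points T B (mk T (t, z)), ?_, rfl⟩
        rw [points_mk]
        exact isLocallyFiniteSet_image_sub _ _
      ergodic := ergodicVAdd h.ergodic
      meyer := .of_forall fun ω => by
        obtain ⟨⟨t, z⟩, rfl⟩ := mk_surjective T ω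
        refine ⟨points T B (mk T (t, z)), ?_, rfl⟩
        rw [points_mk]
        exact isMeyerSet_image_sub (hstep z) _ }

/-- Normalizing the representative to time in `[0, 1)` makes the translation a well-defined
measurable function; the sign comes from `points` being `Λ_z - t`. -/
theorem isTwoSyndeticInRandomTranslate {B : Set Z} (hB : ∀ z, z ∉ B → T z ∈ B) :
    IsTwoSyndeticInRandomTranslate (process T B) := by
  refine ⟨fun ω => -time T ω, (measurable_time T).neg, fun ω =>
    ⟨{n : ℤ | (T ^ n) (base T ω) ∈ B}, isTwoSyndetic_of_forall fun n hn => ?_, ?_⟩⟩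
  · have := hB _ hn
    rwa [← Equiv.Perm.mul_apply, ← zpow_one_add, add_comm] at this
  · conv_lhs => rw [← mk_time_base T ω]
    rw [process, points_mk]
    rfl

end Suspension

/-! ### The asymptotic number variance -/

/-- A bounded perturbation of a centered random variable changes the variance by little. -/
theorem abs_variance_sub_integral_sq_le {Ω : Type*} [MeasurableSpace Ω] {P : Measure Ω}
    [IsProbabilityMeasure P] {X A : Ω → ℝ} (hX : Measurable X) (hA : MemLp A 2 P)
    (hA0 : ∫ ω, A ω ∂P = 0) {b C s : ℝ} (hs : 0 < s) (hC : 0 ≤ C)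
    (h : ∀ᵐ ω ∂P, |X ω - b - A ω| ≤ C) :
    |Var[X; P] - ∫ ω, A ω ^ 2 ∂P| ≤ C * ((∫ ω, A ω ^ 2 ∂P) / s + s) + C ^ 2 := by
  set E : Ω → ℝ := fun ω => X ω - b - A ω with hE
  have hEm : AEStronglyMeasurable E P :=
    (hX.aestronglyMeasurable.sub aestronglyMeasurable_const).sub hA.aestronglyMeasurable
  have hE2 : MemLp E 2 P := .of_bound hEm C h
  have hXe : X = fun ω => (A + E) ω + b := by
    ext ω
    simp [hE]
  have hAE : Integrable (A * E) P := hA.integrable_mul hE2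
  have hA2 := hA.integrable_sq
  have hAi : Integrable A P := hA.integrable one_le_two
  have hvar : Var[X; P] = ∫ ω, A ω ^ 2 ∂P + 2 * ∫ ω, A ω * E ω ∂P + Var[E; P] := by
    conv_lhs => rw [hXe]
    rw [variance_add_const (hA.aestronglyMeasurable.add hEm), variance_add hA hE2,
      variance_of_integral_eq_zero hA.aestronglyMeasurable.aemeasurable hA0,
      covariance_eq_sub hA hE2, hA0, zero_mul, sub_zero]
    rfl
  have hVE : Var[E; P] ≤ C ^ 2 := by
    refine (variance_le_expectation_sq hEm).trans ?_
    have : ∀ᵐ ω ∂P, (E ^ 2) ω ≤ C ^ 2 := by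
      filter_upwards [h] with ω hω
      exact sq_le_sq' (abs_le.1 hω).1 (abs_le.1 hω).2
    simpa using integral_mono_ae hE2.integrable_sq (integrable_const (C ^ 2)) this
  have hcov : |2 * ∫ ω, A ω * E ω ∂P| ≤ C * ((∫ ω, A ω ^ 2 ∂P) / s + s) := by
    have hb : ∀ᵐ ω ∂P, ‖2 * (A ω * E ω)‖ ≤ C * (A ω ^ 2 / s + s) := by
      filter_upwards [h] with ω hω
      -- The weighted arithmetic-geometric inequality replaces Cauchy–Schwarz; the weight `s` stays
      -- free, to be chosen as a function of `R`.
      have h1 : 2 * |A ω| ≤ A ω ^ 2 / s + s := by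
        have e : A ω ^ 2 / s + s - 2 * |A ω| = (|A ω| - s) ^ 2 / s := by
          rw [← sq_abs (A ω)]
          field_simp
          ring
        have : 0 ≤ (|A ω| - s) ^ 2 / s := by positivity
        linarith
      rw [Real.norm_eq_abs, abs_mul, abs_mul, abs_two, ← mul_assoc, mul_comm]
      exact mul_le_mul hω h1 (by positivity) hC
    have hi : Integrable (fun ω => A ω ^ 2 / s + s) P :=
      (hA2.div_const s).add (integrable_const s)
    have := norm_integral_le_of_norm_le (hi.const_mul C) hb
    rw [integral_const_mul, integral_const_mul, integral_add (hA2.div_const s) (integrable_const s),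
      integral_div] at this
    simpa using this
  have h0 := variance_nonneg E P
  rw [hvar, abs_le]
  rw [abs_le] at hcov
  constructor <;> linarith [hcov.1, hcov.2]

/-- With `s = √(2R)` both error terms `W R / s` and `s` are of order `√R`, negligible against `2R`.
-/
theorem tendsto_div_of_abs_sub_le {V W : ℝ → ℝ} {v C : ℝ} (hv : 0 ≤ v) (hC : 0 ≤ C)
    (hW : ∀ R, 1 ≤ R → |W R - 2 * R * v| ≤ v)
    (hV : ∀ R, 1 ≤ R → ∀ s, 0 < s → |V R - W R| ≤ C * (W R / s + s) + C ^ 2) :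
    Tendsto (fun R => V R / (2 * R)) atTop (𝓝 v) := by
  rw [tendsto_iff_norm_sub_tendsto_zero]
  set D : ℝ := C * (2 * v + 1) + C ^ 2 + v with hD
  have hlim : Tendsto (fun R : ℝ => D / √(2 * R)) atTop (𝓝 0) :=
    tendsto_const_nhds.div_atTop
      (Real.tendsto_sqrt_atTop.comp (tendsto_id.const_mul_atTop two_pos))
  refine squeeze_zero' (.of_forall fun R => norm_nonneg _) ?_ hlim
  filter_upwards [eventually_ge_atTop 1] with R hR
  set s := √(2 * R) with hs
  have hs2 : s ^ 2 = 2 * R := Real.sq_sqrt (by linarith)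
  have hs1 : 1 ≤ s := Real.one_le_sqrt.2 (by linarith)
  have hs0 : 0 < s := one_pos.trans_le hs1
  have h1 := abs_le.1 (hW R hR)
  have h2 := abs_le.1 (hV R hR s hs0)
  rw [← hs2] at h1 ⊢
  have h3 : W R / s ≤ 2 * v * s := by
    rw [div_le_iff₀ hs0]
    nlinarith [mul_nonneg hv (sub_nonneg.2 hs1), mul_nonneg hv (sq_nonneg (s - 1))]
  have h4 : |V R - s ^ 2 * v| ≤ D * s := by
    have h5 : C * (W R / s + s) ≤ C * ((2 * v + 1) * s) :=
      mul_le_mul_of_nonneg_left (by linarith) hC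
    have h6 : C ^ 2 + v ≤ (C ^ 2 + v) * s := le_mul_of_one_le_right (by positivity) hs1
    rw [abs_le, hD]
    constructor <;> linarith [h1.1, h1.2, h2.1, h2.2]
  have e : V R / s ^ 2 - v = (V R - s ^ 2 * v) / s ^ 2 := by field_simp
  rw [e, Real.norm_eq_abs, abs_div, abs_of_pos (by positivity : 0 < s ^ 2),
    div_le_div_iff₀ (by positivity) hs0]
  calc |V R - s ^ 2 * v| * s ≤ D * s * s := mul_le_mul_of_nonneg_right h4 hs0.le
    _ = D * s ^ 2 := by ring

/-! ### Number variance of the window process -/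

namespace Solenoid

open UnitAddCircle

/-- The sum of the martingale differences over the integers at distance less than `R` from `t`. -/
noncomputable def martingaleSum (q : ℝ) (N : ℕ) (R : ℝ) (v : ℝ × Solenoid) : ℝ :=
  ∑ n ∈ Suspension.window v.1 R, martingale q N ((doublingPerm ^ n) v.2)

/-- The range of summation depends on `t` only through two integer endpoints, so measurability is
checked for each of countably many pairs. -/
theorem measurable_martingaleSum (q : ℝ) (N : ℕ) (R : ℝ) : Measurable (martingaleSum q N R) := by
  have h : Measurable fun w : (ℤ × ℤ) × Solenoid =>
      ∑ n ∈ Finset.Ico w.1.1 w.1.2, martingale q N ((doublingPerm ^ n) w.2) := by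
    refine measurable_from_prod_countable_right fun αβ => ?_
    dsimp only
    exact Finset.measurable_fun_sum _ fun n _ => measurable_martingale_zpow q N n
  have h1 : Measurable fun v : ℝ × Solenoid => ⌊v.1 - R⌋ + 1 :=
    (Int.measurable_floor.comp (measurable_fst.sub_const R)).add_const 1
  have h2 : Measurable fun v : ℝ × Solenoid => ⌈v.1 + R⌉ :=
    Int.measurable_ceil.comp (measurable_fst.add_const R)
  have h3 := h.comp ((h1.prodMk h2).prodMk measurable_snd)
  simp only [Function.comp_def] at h3
  exact h3

theorem abs_martingaleSum_le (q : ℝ) (N : ℕ) {R : ℝ} (hR : 1 ≤ R) (v : ℝ × Solenoid) :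
    |martingaleSum q N R v| ≤ (2 * R + 1) * (N + 2) := by
  refine (Finset.abs_sum_le_sum_abs _ _).trans ?_
  refine (Finset.sum_le_sum fun n _ => abs_martingale_le q N _).trans ?_
  rw [Finset.sum_const, nsmul_eq_mul]
  refine mul_le_mul_of_nonneg_right ?_ (by positivity)
  linarith [(abs_le.1 (Suspension.abs_card_window_sub_le v.1 hR)).2]

/-- The measure on the fundamental domain of the suspension. -/
noncomputable def domainMeasure : Measure (ℝ × Solenoid) :=
  (volume.restrict (Set.Ico (0 : ℝ) 1)).prod haar

instance : IsProbabilityMeasure domainMeasure :=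
  inferInstanceAs (IsProbabilityMeasure ((volume.restrict (Set.Ico (0 : ℝ) 1)).prod haar))

theorem integral_martingaleSum (q : ℝ) (N : ℕ) {R : ℝ} (hR : 1 ≤ R) :
    ∫ v, martingaleSum q N R v ∂domainMeasure = 0 := by
  have hi : Integrable (martingaleSum q N R) domainMeasure :=
    integrable_of_bounded (measurable_martingaleSum q N R) (abs_martingaleSum_le q N hR)
  rw [domainMeasure, integral_prod _ hi]
  have : ∀ t : ℝ, ∫ a, martingaleSum q N R (t, a) ∂haar = 0 := fun t => by
    simp only [martingaleSum]
    rw [integral_finsetSum _ fun n _ => integrable_of_bounded (measurable_martingale_zpow q N n)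
      fun a => abs_martingale_le q N _]
    exact Finset.sum_eq_zero fun n _ => integral_martingale q N n
  simp [this]

/-- For fixed `t`, orthogonality gives the number of integers in the interval times `‖M‖²`, and that
number is within `1` of `2R`. -/
theorem abs_integral_martingaleSum_sq_sub_le (q : ℝ) (N : ℕ) {R : ℝ} (hR : 1 ≤ R) :
    |∫ v, martingaleSum q N R v ^ 2 ∂domainMeasure - 2 * R * ∫ x, windowMartingale q N x ^ 2|
      ≤ ∫ x, windowMartingale q N x ^ 2 := by
  set V := ∫ x, windowMartingale q N x ^ 2 with hV
  have hV0 : 0 ≤ V := integral_nonneg fun x => sq_nonneg _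
  have hi : Integrable (fun v => martingaleSum q N R v ^ 2) domainMeasure :=
    integrable_of_bounded ((measurable_martingaleSum q N R).pow_const 2)
      (C := ((2 * R + 1) * (N + 2)) ^ 2) fun v => by
        rw [abs_pow]
        exact pow_le_pow_left₀ (abs_nonneg _) (abs_martingaleSum_le q N hR v) 2
  have hslice : ∀ t : ℝ, ∫ a, martingaleSum q N R (t, a) ^ 2 ∂haar
      = (Suspension.window t R).card * V := fun t =>
    integral_sum_martingale_sq q N (Suspension.window t R)
  have hg := hi.integral_prod_left
  rw [domainMeasure, integral_prod _ hi]
  simp only [hslice] at hg ⊢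
  have e : ∫ t in Set.Ico (0 : ℝ) 1, ((Suspension.window t R).card * V - 2 * R * V)
      = (∫ t in Set.Ico (0 : ℝ) 1, (Suspension.window t R).card * V) - 2 * R * V := by
    rw [integral_sub hg (integrable_const _)]
    simp
  rw [← e]
  have := norm_integral_le_of_norm_le_const (μ := volume.restrict (Set.Ico (0 : ℝ) 1))
    (f := fun t => (Suspension.window t R).card * V - 2 * R * V) (C := V) (.of_forall fun t => by
      rw [← sub_mul, Real.norm_eq_abs, abs_mul, abs_of_nonneg hV0]
      exact mul_le_of_le_one_left hV0 (Suspension.abs_card_window_sub_le t hR))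
  simpa using this

variable {q : ℝ}

theorem process_real_ball (hq : 1 / 2 < q) (hq1 : q < 1) (t : ℝ) (a : Solenoid) (R : ℝ) :
    (Suspension.process doublingPerm (windowSet q) (Suspension.mk doublingPerm (t, a))).real
        (Metric.ball 0 R)
      = (Suspension.window t R).card * (3 / 2 - q)
        + ∑ n ∈ Suspension.window t R, window q (proj ((doublingPerm ^ n) a)) := by
  rw [measureReal_def, Suspension.process_mk_ball, ENNReal.toReal_sum fun n _ => ?_,
    ← nsmul_eq_mul, ← Finset.sum_const, ← Finset.sum_add_distrib]
  · refine Finset.sum_congr rfl fun n _ => ?_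
    rw [← indicator_windowSet hq hq1]
    classical
    simp only [Set.indicator_apply]
    split_ifs <;> simp
  · exact ne_top_of_le_ne_top ENNReal.one_ne_top
      (Set.indicator_apply_le' (fun _ => le_rfl) fun _ => zero_le_one)

theorem hasAsymptoticNumberVariance (hq : 1 / 2 < q) (hq1 : q < 1) {k : ℤ} {N : ℕ}
    (hk : q = k / 2 ^ N) :
    HasAsymptoticNumberVariance (Suspension.measure doublingPerm haar)
      (Suspension.process doublingPerm (windowSet q)) (∫ x, windowMartingale q N x ^ 2) := by
  have hvol : ∀ᶠ R : ℝ in atTop, numberVariance (Suspension.measure doublingPerm haar)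
      (Suspension.process doublingPerm (windowSet q)) R / (2 * R)
      = numberVariance (Suspension.measure doublingPerm haar)
      (Suspension.process doublingPerm (windowSet q)) R / volume.real (Metric.ball (0 : ℝ) R) := by
    filter_upwards [eventually_ge_atTop 0] with R hR
    rw [Real.volume_real_ball hR]
  refine Tendsto.congr' hvol ?_
  -- The first summand of `C` bounds the transfer terms at the two ends; the second bounds the
  -- fluctuation in the number of integers, times the measure of the window.
  refine tendsto_div_of_abs_sub_le (C := 2 * (N + 2) + (3 / 2 - q))
    (W := fun R => ∫ v, martingaleSum q N R v ^ 2 ∂domainMeasure)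
    (integral_nonneg fun x => sq_nonneg _) (by linarith [(Nat.cast_nonneg N : (0 : ℝ) ≤ N)])
    (fun R hR => abs_integral_martingaleSum_sq_sub_le q N hR) fun R hR s hs => ?_
  set X : ℝ × Solenoid → ℝ := fun v =>
    (Suspension.process doublingPerm (windowSet q) (Suspension.mk doublingPerm v)).real
      (Metric.ball 0 R) with hXdef
  have hp : Measurable fun ω : Suspension doublingPerm =>
      (Suspension.process doublingPerm (windowSet q) ω).real (Metric.ball 0 R) :=
    ((Measure.measurable_coe Metric.isOpen_ball.measurableSet).comp
      (Suspension.measurable_process measurePreserving_doublingPerm.measurable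
        measurable_doublingPerm_symm (measurableSet_windowSet hq))).ennreal_toReal
  have hX : Measurable X := hp.comp (Suspension.measurable_mk doublingPerm)
  have hvar : numberVariance (Suspension.measure doublingPerm haar)
      (Suspension.process doublingPerm (windowSet q)) R = Var[X; domainMeasure] :=
    variance_map hp.aemeasurable (Suspension.measurable_mk doublingPerm).aemeasurable
  rw [hvar]
  refine abs_variance_sub_integral_sq_le (b := 2 * R * (3 / 2 - q)) hX
    (.of_bound (measurable_martingaleSum q N R).aestronglyMeasurable _
      (.of_forall fun v => abs_martingaleSum_le q N hR v))
    (integral_martingaleSum q N hR) hs (by linarith [(Nat.cast_nonneg N : (0 : ℝ) ≤ N)]) ?_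
  have hae : ∀ᵐ v ∂domainMeasure, ∀ α β : ℤ,
      |∑ n ∈ Finset.Ico α β, window q (proj ((doublingPerm ^ n) v.2))
        - ∑ n ∈ Finset.Ico α β, martingale q N ((doublingPerm ^ n) v.2)| ≤ 2 * (N + 2) :=
    (Measure.quasiMeasurePreserving_snd (μ := volume.restrict (Set.Ico (0 : ℝ) 1))
      (ν := haar)).tendsto_ae.eventually (ae_abs_sum_window_sub_sum_martingale_le hk)
  filter_upwards [hae] with ⟨t, a⟩ ha
  have h1 := ha (⌊t - R⌋ + 1) ⌈t + R⌉
  have h2 := Suspension.abs_card_window_sub_le t hR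
  have hc : (0 : ℝ) ≤ 3 / 2 - q := by linarith
  have e : X (t, a) - 2 * R * (3 / 2 - q) - martingaleSum q N R (t, a)
      = (∑ n ∈ Suspension.window t R, window q (proj ((doublingPerm ^ n) a))
        - ∑ n ∈ Suspension.window t R, martingale q N ((doublingPerm ^ n) a))
        + ((Suspension.window t R).card - 2 * R) * (3 / 2 - q) := by
    simp only [hXdef, process_real_ball hq hq1, martingaleSum]
    ring
  rw [e]
  refine (abs_add_le _ _).trans (add_le_add h1 ?_)
  rw [abs_mul, abs_of_nonneg hc]
  exact mul_le_of_le_one_left hc h2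

end Solenoid

theorem mainTheorem3 :
    ∃ S : Set ℝ, S ⊆ Set.Ioc (1 / 2 : ℝ) (3 / 4) ∧ Set.Ioc (1 / 2 : ℝ) (3 / 4) ⊆ closure S ∧
      ∀ q ∈ S,
        IsSuspensionParameter Solenoid.haar Solenoid.doublingPerm (Solenoid.windowSet q) ∧
        HasSummableCorrelations Solenoid.haar Solenoid.doublingPerm (Solenoid.windowSet q) ∧
        ¬ IsL2Coboundary Solenoid.haar Solenoid.doublingPerm
          (centeredIndicator Solenoid.haar (Solenoid.windowSet q)) ∧
        IsMeyerianPointProcess (Suspension.measure Solenoid.doublingPerm Solenoid.haar)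
          (Suspension.process Solenoid.doublingPerm (Solenoid.windowSet q)) ∧
        IsTwoSyndeticInRandomTranslate
          (Suspension.process Solenoid.doublingPerm (Solenoid.windowSet q)) ∧
        ∃ v : ℝ, 0 < v ∧
          HasAsymptoticNumberVariance (Suspension.measure Solenoid.doublingPerm Solenoid.haar)
            (Suspension.process Solenoid.doublingPerm (Solenoid.windowSet q)) v := by
  refine ⟨{q | q ∈ Set.Ioc (1 / 2 : ℝ) (3 / 4) ∧ ∃ (k : ℤ) (N : ℕ), q = k / 2 ^ N},
    fun q hq => hq.1, fun x hx => ?_, ?_⟩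
  · rw [Metric.mem_closure_iff]
    intro ε hε
    -- Approximating from below keeps the dyadic point in `(1/2, 3/4]`, also when `x = 3/4`.
    obtain ⟨k, N, h1, h2⟩ := exists_dyadic_between (max_lt hx.1 (sub_lt_self x hε))
    refine ⟨k / 2 ^ N, ⟨⟨(le_max_left _ _).trans_lt h1, h2.le.trans hx.2⟩, k, N, rfl⟩, ?_⟩
    rw [Real.dist_eq, abs_of_pos (by linarith)]
    linarith [(le_max_right (1 / 2) (x - ε)).trans_lt h1]
  · rintro q ⟨⟨hq, hq'⟩, k, N, hk⟩
    have hq1 : q < 1 := by linarith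
    have hstep : ∀ a, a ∉ Solenoid.windowSet q →
        Solenoid.doublingPerm a ∈ Solenoid.windowSet q :=
      fun a => Solenoid.doublingPerm_mem_windowSet hq hq'
    have hpar := Solenoid.isSuspensionParameter hq hq'
    exact ⟨hpar, Solenoid.hasSummableCorrelations hq hq1, Solenoid.not_isL2Coboundary hq hq1 hk,
      Suspension.isMeyerianPointProcess hpar hstep,
      Suspension.isTwoSyndeticInRandomTranslate hstep, _,
      UnitAddCircle.integral_windowMartingale_sq_pos hq hq1 N,
      Solenoid.hasAsymptoticNumberVariance hq hq1 hk⟩
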